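/- All posets are finite. A poset is \emph{graded} if all its maximal chains have the same number of elements; this number is its \emph{height} (so the empty poset is graded of height $0$). A poset is an \emph{interval order} if it is $(2+2)$-avoiding, i.e. has no induced subposet isomorphic to the disjoint union of two mutually incomparable $2$-element chains. Let $p_{n,k}$ be the number of graded interval orders of height $k$ on the labeled vertex set $\{1,\dots,n\}$, and $p_n$ the number of all graded interval orders on $\{1,\dots,n\}$ (with $p_0=1$). Put $$\psi_{2+2}(m,n)=\sum_{j\ge 0}(j!)^2\,S(n,j)\,S(m,j),$$ where $S$ denotes the Stirling numbers of the second kind, and let $A=(A_{mn})_{m,n\ge 0}$ be the infinite matrix of formal power series $$A_{mn}=\sum_{l=0}^{\infty}\frac{x^{l+n}}{l!\,n!}\sum_{m'=0}^{m}\binom{m}{m'}\psi_{2+2}(n,l+m').$$ Infinite sums of power series are taken formally, i.e. each coefficient is a sum with only finitely many nonzero terms. Then the entries of $A$ and of all its powers exist, and for every $k\ge 0$ $$\sum_{n\ge 0}p_{n,k}\frac{x^n}{n!}=(e^x-1)^k\,[A^k]_{0,0}.$$ Moreover, the infinite matrix $I-(e^x-1)A$ has a two-sided inverse (with all products existing formally),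 this inverse is unique, and $$\sum_{n\ge 0}p_{n}\frac{x^n}{n!}=\big[(I-(e^x-1)A)^{-1}\big]_{0,0};$$ the product $(I-(e^x-1)A)^{-1}A$ exists, and, leaving out the empty poset, $$\sum_{n\ge 1}p_{n}\frac{x^n}{n!}=(e^x-1)\,\big[(I-(e^x-1)A)^{-1}A\big]_{0,0}.$$ -/

import Mathlib

open scoped PowerSeries Nat

/-! ### Graded interval orders -/

/-- A poset is an interval order if it avoids `2 + 2`, that is, if it has no induced subposet
isomorphic to the disjoint (mutually incomparable) union of two 2-element chains. The order that
Mathlib puts on `Fin 2 ⊕ Fin 2` is this disjoint union. -/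
def IsIntervalOrder (α : Type*) [PartialOrder α] : Prop :=
  IsEmpty ((Fin 2 ⊕ Fin 2) ↪o α)

/-- A finite poset is (strongly) graded if all its maximal chains have the same length. -/
def IsGradedPoset (α : Type*) [PartialOrder α] : Prop :=
  ∀ s t : Set α, IsMaxChain (· ≤ ·) s → IsMaxChain (· ≤ ·) t → s.ncard = t.ncard

/-- A finite graded poset of height `k`: there are exactly `k` ranks, that is, each maximal chain
has exactly `k` elements. -/
def IsGradedOfHeight (α : Type*) [PartialOrder α] (k : ℕ) : Prop :=
  IsGradedPoset α ∧ ∀ s : Set α, IsMaxChain (· ≤ ·) s → s.ncard = k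

/-- The number of graded interval orders of height `k` labeled by an `n`-element set. -/
noncomputable def numGradedIntervalOrdersOfHeight (n k : ℕ) : ℕ :=
  {P : PartialOrder (Fin n) | @IsIntervalOrder (Fin n) P ∧ @IsGradedOfHeight (Fin n) P k}.ncard

/-- The number of graded interval orders labeled by an `n`-element set. -/
noncomputable def numGradedIntervalOrders (n : ℕ) : ℕ :=
  {P : PartialOrder (Fin n) | @IsIntervalOrder (Fin n) P ∧ @IsGradedPoset (Fin n) P}.ncard

/-- The exponential generating function of a sequence. -/
noncomputable def egf (e : ℕ → ℕ) : ℚ⟦X⟧ :=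
  PowerSeries.mk fun n => (e n : ℚ) / (n ! : ℚ)

/-! ### Formal sums and infinite matrices over formal power series -/

/-- A family of power series is formally summable if each power of the variable occurs in only
finitely many members of the family. -/
def FormallySummable {ι : Type*} (f : ι → ℚ⟦X⟧) : Prop :=
  ∀ d : ℕ, {i | PowerSeries.coeff d (f i) ≠ 0}.Finite

/-- The sum of a formally summable family, computed coefficientwise. -/
noncomputable def formalSum {ι : Type*} (f : ι → ℚ⟦X⟧) : ℚ⟦X⟧ :=
  PowerSeries.mk fun d => ∑ᶠ i, PowerSeries.coeff d (f i)

/-- The entries of the product of the infinite matrices `B` and `C` exist as formal sums. -/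
def FormallyMultipliable (B C : Matrix ℕ ℕ ℚ⟦X⟧) : Prop :=
  ∀ m n : ℕ, FormallySummable fun p : ℕ => B m p * C p n

/-- The product of two infinite matrices, `(B C) m n = ∑ p, B m p * C p n`. -/
noncomputable def formalMul (B C : Matrix ℕ ℕ ℚ⟦X⟧) : Matrix ℕ ℕ ℚ⟦X⟧ :=
  fun m n => formalSum fun p : ℕ => B m p * C p n

/-- Powers of an infinite matrix. -/
noncomputable def formalPow (B : Matrix ℕ ℕ ℚ⟦X⟧) : ℕ → Matrix ℕ ℕ ℚ⟦X⟧
  | 0 => 1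
  | k + 1 => formalMul (formalPow B k) B

/-- `C` is a two-sided inverse of the infinite matrix `B`. -/
def IsFormalInverse (B C : Matrix ℕ ℕ ℚ⟦X⟧) : Prop :=
  FormallyMultipliable B C ∧ formalMul B C = 1 ∧ FormallyMultipliable C B ∧ formalMul C B = 1

/-! ### The transfer matrix -/

/-- `ψ(m, n) = ∑_{j ≥ 0} (j!)² S(n, j) S(m, j)` with `S` the Stirling numbers of the second kind;
the terms with `j > n` vanish because `S(n, j) = 0` for them. -/
def psiTwoTwo (m n : ℕ) : ℕ :=
  ∑ j ∈ Finset.range (n + 1), (j !) ^ 2 * Nat.stirlingSecond n j * Nat.stirlingSecond m j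

/-- The `l`-th term of the series that defines the entry `A m n` of the transfer matrix,
`x ^ (l + n) / (l! n!) * ∑_{m' = 0}^{m} (m choose m') ψ(n, l + m')`. -/
noncomputable def transferTerm (m n l : ℕ) : ℚ⟦X⟧ :=
  PowerSeries.monomial (l + n)
    ((1 : ℚ) / ((l ! : ℚ) * (n ! : ℚ)) *
      ∑ m' ∈ Finset.range (m + 1), (m.choose m' : ℚ) * (psiTwoTwo n (l + m') : ℚ))

/-- The transfer matrix `A`, with rows and columns indexed by `0, 1, 2, …`. -/
noncomputable def transferMatrix : Matrix ℕ ℕ ℚ⟦X⟧ :=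
  fun m n => formalSum fun l : ℕ => transferTerm m n l

/-- The power series `e ^ x - 1`. -/
noncomputable def expSubOne : ℚ⟦X⟧ := PowerSeries.exp ℚ - 1

/-! In a graded interval order of height `k`, two vertices whose ranks differ by at least two are
always comparable. The order is therefore encoded by its rank function and by the "gap" relation
`T`: incomparability between vertices of adjacent ranks. Avoiding `2 + 2` says that between any two
adjacent ranks `T` is a Ferrers relation (its neighbourhoods form a chain). Gradedness says that
every rank contains a vertex not involved in `T`. `ncard_graded_eq_card_rankedGap` turns this
encoding into a count.

Colour each vertex by its rank and by whether it has `T`-neighbours below and above. Once the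
colouring is fixed, the gaps are independent, and each carries a Ferrers relation without isolated
vertices. Such a relation is a number `j` of levels with a surjection from either side onto them,
hence the count `ψ` (`card_isFerrers`).

The exponential generating function is thus a sum over the colour counts. Splitting off the top rank
(`openSeries_succ`), its uninvolved vertices contribute `e ^ x - 1`, and the other three kinds
contribute one multiplication by `A`. The index passed along is the number of vertices with a
`T`-neighbour below.

For the total count, `A` is row-finite modulo each power of `x` and `e ^ x - 1` is divisible by `x`,
so the geometric series of `(e ^ x - 1) A` converges formally and is the inverse sought. -/

/-! ### Formal sums -/

section FormalSum

variable {ι κ : Type*}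

theorem coeff_formalSum (f : ι → ℚ⟦X⟧) (d : ℕ) :
    PowerSeries.coeff d (formalSum f) = ∑ᶠ i, PowerSeries.coeff d (f i) := by
  simp [formalSum]

theorem FormallySummable.of_dvd {f : ι → ℚ⟦X⟧} (deg : ι → ℕ)
    (h : ∀ i, (PowerSeries.X : ℚ⟦X⟧) ^ deg i ∣ f i) (fin : ∀ d, {i | deg i ≤ d}.Finite) :
    FormallySummable f := by
  intro d
  refine (fin d).subset fun i hi => ?_
  by_contra hd
  exact hi (PowerSeries.X_pow_dvd_iff.1 (h i) d (by simpa using hd))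

theorem FormallySummable.comp_injective {f : ι → ℚ⟦X⟧} (hf : FormallySummable f) {e : κ → ι}
    (he : Function.Injective e) : FormallySummable fun k => f (e k) :=
  fun d => (hf d).preimage he.injOn

theorem formalSum_comp_equiv (e : κ ≃ ι) (f : ι → ℚ⟦X⟧) :
    formalSum (fun k => f (e k)) = formalSum f := by
  ext d
  simp only [coeff_formalSum]
  exact finsum_comp_equiv e (f := fun i => PowerSeries.coeff d (f i))

theorem FormallySummable.mul_left {f : ι → ℚ⟦X⟧} (hf : FormallySummable f) (c : ℚ⟦X⟧) :
    FormallySummable fun i => c * f i := by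
  intro d
  refine ((Finset.range (d + 1)).finite_toSet.biUnion fun e _ => hf e).subset fun i hi => ?_
  by_contra h
  simp only [Set.mem_iUnion, not_exists] at h
  refine hi ?_
  rw [PowerSeries.coeff_mul]
  refine Finset.sum_eq_zero fun p hp => ?_
  have h2 := h p.2 (by
    have := Finset.HasAntidiagonal.mem_antidiagonal.1 hp
    exact Finset.mem_coe.2 (Finset.mem_range.2 (by omega)))
  simp only [Set.mem_ofPred_eq, not_not] at h2
  rw [h2, mul_zero]

theorem formalSum_mul_left {f : ι → ℚ⟦X⟧} (hf : FormallySummable f) (c : ℚ⟦X⟧) :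
    formalSum (fun i => c * f i) = c * formalSum f := by
  ext d
  simp only [coeff_formalSum, PowerSeries.coeff_mul]
  rw [finsum_sum_comm]
  · refine Finset.sum_congr rfl fun p _ => ?_
    rw [mul_finsum]
  · intro p _
    refine (hf p.2).subset fun i hi => ?_
    exact right_ne_zero_of_mul hi

theorem formalSum_mul_right {f : ι → ℚ⟦X⟧} (hf : FormallySummable f) (c : ℚ⟦X⟧) :
    formalSum (fun i => f i * c) = formalSum f * c := by
  simpa only [mul_comm] using formalSum_mul_left hf c

theorem formalSum_prod {f : ι × κ → ℚ⟦X⟧} (hf : FormallySummable f) :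
    formalSum f = formalSum fun i => formalSum fun k => f (i, k) := by
  ext d
  simp only [coeff_formalSum]
  exact finsum_curry _ (hf d)

theorem FormallySummable.swap {f : ι × κ → ℚ⟦X⟧} (hf : FormallySummable f) :
    FormallySummable fun p : κ × ι => f (p.2, p.1) :=
  hf.comp_injective (e := fun p : κ × ι => (p.2, p.1)) (Prod.swap_injective)

theorem formalSum_comm {f : ι × κ → ℚ⟦X⟧} (hf : FormallySummable f) :
    (formalSum fun i => formalSum fun k => f (i, k)) =
      formalSum fun k => formalSum fun i => f (i, k) := by
  rw [← formalSum_prod hf, ← formalSum_prod hf.swap]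
  exact (formalSum_comp_equiv (Equiv.prodComm κ ι) f).symm

theorem formalSum_sigma_fintype {σ : ι → Type*} [∀ i, Fintype (σ i)] {f : (Σ i, σ i) → ℚ⟦X⟧}
    (hf : FormallySummable f) :
    formalSum f = formalSum fun i => ∑ k, f ⟨i, k⟩ := by
  ext d
  simp only [coeff_formalSum, map_sum]
  have h := hf d
  classical
  set s : Finset (Σ i, σ i) := h.toFinset
  rw [finsum_eq_sum_of_support_subset (s := (s.image Sigma.fst).sigma fun _ => Finset.univ)]
  · rw [Finset.sum_sigma, finsum_eq_sum_of_support_subset (s := s.image Sigma.fst)]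
    intro i hi
    obtain ⟨k, -, hk⟩ := Finset.exists_ne_zero_of_sum_ne_zero hi
    exact Finset.mem_coe.2 (Finset.mem_image.2 ⟨⟨i, k⟩, by simpa [s] using hk, rfl⟩)
  · intro p hp
    simp only [Finset.coe_sigma, Set.mem_sigma_iff, Finset.mem_coe, Finset.mem_univ, and_true]
    exact Finset.mem_image.2 ⟨p, by simpa [s] using hp, rfl⟩

theorem formalSum_of_support_subset {f : ι → ℚ⟦X⟧} {s : Finset ι}
    (hs : ∀ i, i ∉ s → f i = 0) : formalSum f = ∑ i ∈ s, f i := by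
  ext d
  rw [coeff_formalSum, map_sum]
  refine finsum_eq_sum_of_support_subset _ fun i hi => ?_
  by_contra h
  exact hi (by simp [hs i h])

theorem formalSum_eq_single {f : ι → ℚ⟦X⟧} (i : ι) (h : ∀ j, j ≠ i → f j = 0) :
    formalSum f = f i := by
  rw [formalSum_of_support_subset (s := {i}) (by simpa using h), Finset.sum_singleton]

theorem formalSum_add {f g : ι → ℚ⟦X⟧} (hf : FormallySummable f) (hg : FormallySummable g) :
    formalSum (fun i => f i + g i) = formalSum f + formalSum g := by
  ext d
  simp only [coeff_formalSum, map_add]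
  exact finsum_add_distrib (hf d) (hg d)

theorem dvd_formalSum {f : ι → ℚ⟦X⟧} {n : ℕ} (h : ∀ i, (PowerSeries.X : ℚ⟦X⟧) ^ n ∣ f i) :
    (PowerSeries.X : ℚ⟦X⟧) ^ n ∣ formalSum f := by
  rw [PowerSeries.X_pow_dvd_iff]
  intro m hm
  rw [coeff_formalSum]
  exact finsum_eq_zero_of_forall_eq_zero fun i => PowerSeries.X_pow_dvd_iff.1 (h i) m hm

end FormalSum

/-! ### Row-finite infinite matrices -/

/-- Modulo each power of the variable, the rows of the matrix have finite support. -/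
def RowFinite (B : Matrix ℕ ℕ ℚ⟦X⟧) : Prop :=
  ∀ m d : ℕ, ∃ N, ∀ p, N ≤ p → (PowerSeries.X : ℚ⟦X⟧) ^ d ∣ B m p

namespace RowFinite

variable {B C : Matrix ℕ ℕ ℚ⟦X⟧}

theorem exists_uniform (hB : RowFinite B) (N d : ℕ) :
    ∃ N', ∀ m, m < N → ∀ p, N' ≤ p → (PowerSeries.X : ℚ⟦X⟧) ^ d ∣ B m p := by
  choose f hf using fun m => hB m d
  refine ⟨(Finset.range N).sup f, fun m hm p hp => hf m p (le_trans ?_ hp)⟩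
  exact Finset.le_sup (f := f) (Finset.mem_range.2 hm)

/-- Nothing is asked of `v`: a row-finite left factor can be multiplied by any matrix. This is what
allows uniqueness of the inverse among all matrices. -/
theorem summable (hB : RowFinite B) (m : ℕ) (v : ℕ → ℚ⟦X⟧) :
    FormallySummable fun p => B m p * v p := by
  intro d
  obtain ⟨N, hN⟩ := hB m (d + 1)
  refine (Set.finite_Iio N).subset fun p hp => ?_
  by_contra h
  exact hp (PowerSeries.X_pow_dvd_iff.1 ((hN p (by simpa using h)).mul_right _) d
    (Nat.lt_succ_self d))

theorem multipliable (hB : RowFinite B) (C : Matrix ℕ ℕ ℚ⟦X⟧) : FormallyMultipliable B C :=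
  fun m n => hB.summable m fun p => C p n

theorem mul (hB : RowFinite B) (hC : RowFinite C) : RowFinite (formalMul B C) := by
  intro m d
  obtain ⟨N, hN⟩ := hB m d
  obtain ⟨N', hN'⟩ := hC.exists_uniform N d
  refine ⟨N', fun q hq => dvd_formalSum fun p => ?_⟩
  by_cases hp : p < N
  · exact (hN' p hp q hq).mul_left _
  · exact (hN p (not_lt.1 hp)).mul_right _

theorem one : RowFinite 1 := by
  intro m d
  refine ⟨m + 1, fun p hp => ?_⟩
  rw [Matrix.one_apply_ne (by omega)]
  exact dvd_zero _

theorem smul (hB : RowFinite B) (c : ℚ⟦X⟧) : RowFinite (c • B) := by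
  intro m d
  obtain ⟨N, hN⟩ := hB m d
  exact ⟨N, fun p hp => (hN p hp).mul_left c⟩

theorem sub (hB : RowFinite B) (hC : RowFinite C) : RowFinite (B - C) := by
  intro m d
  obtain ⟨N, hN⟩ := hB m d
  obtain ⟨N', hN'⟩ := hC m d
  exact ⟨max N N', fun p hp =>
    dvd_sub (hN p (le_trans (le_max_left _ _) hp)) (hN' p (le_trans (le_max_right _ _) hp))⟩

theorem pow (hB : RowFinite B) (k : ℕ) : RowFinite (formalPow B k) := by
  induction k with
  | zero => exact one
  | succ k ih => exact ih.mul hB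

end RowFinite

/-! ### Algebra of formal matrix products -/

section FormalMul

variable {B C M : Matrix ℕ ℕ ℚ⟦X⟧}

/-- In a given degree only finitely many `p` matter for row `m` of `B`, and then only finitely many
`q` for those rows of `M`. The double sum is thus finite in each degree whatever `C` is. -/
theorem formalMul_assoc (hB : RowFinite B) (hM : RowFinite M) (C : Matrix ℕ ℕ ℚ⟦X⟧) :
    formalMul (formalMul B M) C = formalMul B (formalMul M C) := by
  ext1 m n
  have hs : FormallySummable fun x : ℕ × ℕ => B m x.1 * M x.1 x.2 * C x.2 n := by
    intro d
    obtain ⟨N, hN⟩ := hB m (d + 1)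
    obtain ⟨N', hN'⟩ := hM.exists_uniform N (d + 1)
    refine ((Set.finite_Iio N).prod (Set.finite_Iio N')).subset fun x hx => ?_
    by_contra h
    refine hx (PowerSeries.X_pow_dvd_iff.1 (Dvd.dvd.mul_right ?_ _) d (Nat.lt_succ_self d))
    by_cases h1 : x.1 < N
    · refine (hN' x.1 h1 x.2 ?_).mul_left _
      by_contra h2
      exact h ⟨h1, by simpa using h2⟩
    · exact (hN x.1 (not_lt.1 h1)).mul_right _
  calc formalMul (formalMul B M) C m n
      = formalSum fun q => formalSum fun p => B m p * M p q * C q n := by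
        unfold formalMul
        congr 1
        ext1 q
        rw [formalSum_mul_right (hB.summable m fun p => M p q)]
    _ = formalSum fun p => formalSum fun q => B m p * M p q * C q n := (formalSum_comm hs).symm
    _ = formalMul B (formalMul M C) m n := by
        unfold formalMul
        congr 1
        ext1 p
        rw [← formalSum_mul_left (hM.summable p fun q => C q n)]
        simp only [mul_assoc]

theorem formalMul_one (B : Matrix ℕ ℕ ℚ⟦X⟧) : formalMul B 1 = B := by
  ext1 m n
  unfold formalMul
  rw [formalSum_eq_single n fun p hp => by rw [Matrix.one_apply_ne hp, mul_zero],
    Matrix.one_apply_eq, mul_one]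

theorem one_formalMul (B : Matrix ℕ ℕ ℚ⟦X⟧) : formalMul 1 B = B := by
  ext1 m n
  unfold formalMul
  rw [formalSum_eq_single m fun p hp => by rw [Matrix.one_apply_ne hp.symm, zero_mul],
    Matrix.one_apply_eq, one_mul]

theorem formalMul_smul (hB : RowFinite B) (c : ℚ⟦X⟧) (C : Matrix ℕ ℕ ℚ⟦X⟧) :
    formalMul B (c • C) = c • formalMul B C := by
  ext1 m n
  simp only [formalMul, Matrix.smul_apply, smul_eq_mul]
  rw [← formalSum_mul_left (hB.summable m fun p => C p n)]
  simp only [mul_left_comm]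

theorem smul_formalMul (hB : RowFinite B) (c : ℚ⟦X⟧) (C : Matrix ℕ ℕ ℚ⟦X⟧) :
    formalMul (c • B) C = c • formalMul B C := by
  ext1 m n
  simp only [formalMul, Matrix.smul_apply, smul_eq_mul]
  rw [← formalSum_mul_left (hB.summable m fun p => C p n)]
  simp only [mul_assoc]

theorem one_sub_formalMul (hB : RowFinite B) (C : Matrix ℕ ℕ ℚ⟦X⟧) :
    formalMul (1 - B) C = C - formalMul B C := by
  rw [eq_sub_iff_add_eq]
  nth_rw 3 [← one_formalMul C]
  ext1 m n
  rw [Matrix.add_apply]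
  unfold formalMul
  rw [← formalSum_add ((RowFinite.one.sub hB).summable m _) (hB.summable m _)]
  simp only [← add_mul, Matrix.sub_apply, sub_add_cancel]

theorem formalMul_one_sub (hB : RowFinite B) (C : Matrix ℕ ℕ ℚ⟦X⟧) :
    formalMul B (1 - C) = B - formalMul B C := by
  rw [eq_sub_iff_add_eq]
  nth_rw 3 [← formalMul_one B]
  ext1 m n
  rw [Matrix.add_apply]
  unfold formalMul
  rw [← formalSum_add (hB.summable m _) (hB.summable m _)]
  simp only [← mul_add, Matrix.sub_apply, sub_add_cancel]

theorem formalPow_smul (hB : RowFinite B) (c : ℚ⟦X⟧) (k : ℕ) :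
    formalPow (c • B) k = c ^ k • formalPow B k := by
  induction k with
  | zero => simp [formalPow]
  | succ k ih =>
    rw [formalPow, ih, smul_formalMul (hB.pow k), formalMul_smul (hB.pow k), smul_smul, formalPow,
      pow_succ]

theorem formalMul_formalPow (hB : RowFinite B) (k : ℕ) :
    formalMul B (formalPow B k) = formalPow B (k + 1) := by
  induction k with
  | zero => simp only [formalPow, formalMul_one, one_formalMul]
  | succ k ih => rw [formalPow, ← formalMul_assoc hB (hB.pow k), ih, ← formalPow]

end FormalMul

/-! ### The geometric series of an infinite matrix -/

/-- The sum of all the powers of an infinite matrix. -/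
noncomputable def formalGeometric (G : Matrix ℕ ℕ ℚ⟦X⟧) : Matrix ℕ ℕ ℚ⟦X⟧ :=
  fun m n => formalSum fun k => formalPow G k m n

section Geometric

variable {G : Matrix ℕ ℕ ℚ⟦X⟧}

/-- Makes the geometric series summable: degree `d` only sees the powers `k ≤ d`. -/
theorem X_pow_dvd_formalPow (hX : ∀ m n, (PowerSeries.X : ℚ⟦X⟧) ∣ G m n) (k m n : ℕ) :
    (PowerSeries.X : ℚ⟦X⟧) ^ k ∣ formalPow G k m n := by
  induction k generalizing m n with
  | zero => simp
  | succ k ih =>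
    refine dvd_formalSum fun p => ?_
    rw [pow_succ]
    exact mul_dvd_mul (ih m p) (hX p n)

theorem formallySummable_formalPow (hX : ∀ m n, (PowerSeries.X : ℚ⟦X⟧) ∣ G m n) (m n : ℕ) :
    FormallySummable fun k => formalPow G k m n :=
  .of_dvd id (fun k => X_pow_dvd_formalPow hX k m n) fun d => Set.finite_Iic d

theorem RowFinite.geometric (hG : RowFinite G) (hX : ∀ m n, (PowerSeries.X : ℚ⟦X⟧) ∣ G m n) :
    RowFinite (formalGeometric G) := by
  intro m d
  choose f hf using fun k => hG.pow k m d
  refine ⟨(Finset.range d).sup f, fun p hp => dvd_formalSum fun k => ?_⟩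
  by_cases hk : k < d
  · exact hf k p (le_trans (Finset.le_sup (f := f) (Finset.mem_range.2 hk)) hp)
  · exact (pow_dvd_pow _ (not_lt.1 hk)).trans (X_pow_dvd_formalPow hX k m p)

theorem formalSum_nat_succ {f : ℕ → ℚ⟦X⟧} (hf : FormallySummable f) :
    formalSum f = f 0 + formalSum fun k => f (k + 1) := by
  ext d
  rw [map_add, coeff_formalSum, coeff_formalSum]
  obtain ⟨N, hN⟩ := (hf d).bddAbove
  have h1 : ∀ k, N < k → PowerSeries.coeff d (f k) = 0 := fun k hk => by
    by_contra hne
    exact absurd (hN hne) (not_le.2 hk)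
  rw [finsum_eq_sum_of_support_subset (s := Finset.range (N + 1 + 1)),
    finsum_eq_sum_of_support_subset (s := Finset.range (N + 1)), Finset.sum_range_succ', add_comm]
  · intro k hk
    by_contra h
    exact hk (h1 _ (by simp at h; omega))
  · intro k hk
    by_contra h
    exact hk (h1 _ (by simp at h; omega))

theorem formalGeometric_eq (hX : ∀ m n, (PowerSeries.X : ℚ⟦X⟧) ∣ G m n) (m n : ℕ) :
    formalGeometric G m n =
      (1 : Matrix ℕ ℕ ℚ⟦X⟧) m n + formalSum fun k => formalPow G (k + 1) m n :=
  formalSum_nat_succ (formallySummable_formalPow hX m n)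

theorem formalMul_geometric (hG : RowFinite G) (hX : ∀ m n, (PowerSeries.X : ℚ⟦X⟧) ∣ G m n) :
    formalMul G (formalGeometric G) = formalGeometric G - 1 := by
  ext1 m n
  rw [Matrix.sub_apply, formalGeometric_eq hX, add_sub_cancel_left]
  have hs : FormallySummable fun x : ℕ × ℕ => G m x.1 * formalPow G x.2 x.1 n := by
    intro d
    obtain ⟨N, hN⟩ := hG m (d + 1)
    refine ((Set.finite_Iio N).prod (Set.finite_Iic d)).subset fun x hx => ?_
    by_contra h
    refine hx ((PowerSeries.X_pow_dvd_iff (n := d + 1)).1 ?_ d (Nat.lt_succ_self d))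
    by_cases h1 : x.1 < N
    · refine Dvd.dvd.mul_left ((pow_dvd_pow _ ?_).trans (X_pow_dvd_formalPow hX _ _ _)) _
      by_contra h2
      exact h ⟨h1, by simp only [Set.mem_Iic]; omega⟩
    · exact (hN x.1 (not_lt.1 h1)).mul_right _
  calc formalMul G (formalGeometric G) m n
      = formalSum fun p => formalSum fun k => G m p * formalPow G k p n := by
        unfold formalMul formalGeometric
        congr 1
        ext1 p
        rw [formalSum_mul_left (formallySummable_formalPow hX p n)]
    _ = formalSum fun k => formalSum fun p => G m p * formalPow G k p n := formalSum_comm hs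
    _ = _ := by
        simp only [← formalMul_formalPow hG]
        rfl

theorem geometric_formalMul (hG : RowFinite G) (hX : ∀ m n, (PowerSeries.X : ℚ⟦X⟧) ∣ G m n) :
    formalMul (formalGeometric G) G = formalGeometric G - 1 := by
  ext1 m n
  rw [Matrix.sub_apply, formalGeometric_eq hX, add_sub_cancel_left]
  have hs : FormallySummable fun x : ℕ × ℕ => formalPow G x.1 m x.2 * G x.2 n := by
    intro d
    have hfin : ∀ k, {p | PowerSeries.coeff d (formalPow G k m p * G p n) ≠ 0}.Finite :=
      fun k => (hG.pow k).summable m (fun p => G p n) d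
    refine ((Set.finite_Iic d).biUnion fun k _ => (hfin k).image (Prod.mk k)).subset
      fun x hx => ?_
    simp only [Set.mem_iUnion]
    refine ⟨x.1, ?_, x.2, hx, rfl⟩
    by_contra h
    exact hx (PowerSeries.X_pow_dvd_iff.1 ((X_pow_dvd_formalPow hX _ _ _).mul_right _) d
      (by simpa using h))
  calc formalMul (formalGeometric G) G m n
      = formalSum fun p => formalSum fun k => formalPow G k m p * G p n := by
        unfold formalMul formalGeometric
        congr 1
        ext1 p
        rw [formalSum_mul_right (formallySummable_formalPow hX m p)]
    _ = formalSum fun k => formalSum fun p => formalPow G k m p * G p n := (formalSum_comm hs).symm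
    _ = _ := rfl

theorem isFormalInverse_geometric (hG : RowFinite G)
    (hX : ∀ m n, (PowerSeries.X : ℚ⟦X⟧) ∣ G m n) : IsFormalInverse (1 - G) (formalGeometric G) := by
  refine ⟨(RowFinite.one.sub hG).multipliable _, ?_, (hG.geometric hX).multipliable _, ?_⟩
  · rw [one_sub_formalMul hG, formalMul_geometric hG hX, sub_sub_cancel]
  · rw [formalMul_one_sub (hG.geometric hX), geometric_formalMul hG hX, sub_sub_cancel]

/-- The usual `C = (B M) C = B (M C) = B`; associativity here needs only `B` and `M` row-finite. -/
theorem IsFormalInverse.unique {M B C : Matrix ℕ ℕ ℚ⟦X⟧} (hM : RowFinite M) (hB : RowFinite B)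
    (h : IsFormalInverse M B) (h' : IsFormalInverse M C) : C = B := by
  rw [← one_formalMul C, ← h.2.2.2, formalMul_assoc hB hM, h'.2.1, formalMul_one]

end Geometric

/-! ### Graded interval orders as ranked gap relations -/

/-- If both `a < d` and `c < b` fail, transitivity excludes all other comparabilities between the
two chains, so they form a `2 + 2`. -/
theorem isIntervalOrder_iff {α : Type*} [PartialOrder α] :
    IsIntervalOrder α ↔ ∀ a b c d : α, a < b → c < d → a < d ∨ c < b := by
  constructor
  · intro h a b c d hab hcd
    by_contra! hn
    obtain ⟨had, hcb⟩ := hn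
    have h1 : ¬ a ≤ d := fun h' => had (lt_of_le_of_ne h' (by rintro rfl; exact hcb (hcd.trans hab)))
    have h2 : ¬ c ≤ b := fun h' => hcb (lt_of_le_of_ne h' (by rintro rfl; exact had (hab.trans hcd)))
    have h3 : ¬ a ≤ c := fun h' => h1 (h'.trans hcd.le)
    have h4 : ¬ c ≤ a := fun h' => h2 (h'.trans hab.le)
    have h5 : ¬ b ≤ d := fun h' => h1 (hab.le.trans h')
    have h6 : ¬ d ≤ b := fun h' => h2 (hcd.le.trans h')
    have h7 : ¬ b ≤ c := fun h' => h3 (hab.le.trans h')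
    have h8 : ¬ d ≤ a := fun h' => h4 (hcd.le.trans h')
    refine h.elim' (OrderEmbedding.ofMapLEIff (Sum.elim ![a, b] ![c, d]) ?_)
    rintro (i | i) (j | j) <;> fin_cases i <;> fin_cases j <;>
      simp [hab.le, hcd.le, hab.not_ge, hcd.not_ge, h1, h2, h3, h4, h5, h6, h7, h8]
  · intro h
    refine ⟨fun e => ?_⟩
    have h1 : e (.inl 0) < e (.inl 1) := by simp
    have h2 : e (.inr 0) < e (.inr 1) := by simp
    rcases h _ _ _ _ h1 h2 with h3 | h3 <;> simp at h3

/-- The data of a graded interval order of height `k`: the rank of each vertex, and the relation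
that holds between two vertices of adjacent ranks which are incomparable. -/
structure IsRankedGap {α : Type*} {k : ℕ} (r : α → Fin k) (T : α → α → Prop) : Prop where
  adj : ∀ a b, T a b → (r b : ℕ) = r a + 1
  ferrers : ∀ a b a' b', T a b → T a' b' → r a = r a' → T a b' ∨ T a' b
  exists_isolated : ∀ i, ∃ v, r v = i ∧ ∀ w, ¬ T v w ∧ ¬ T w v

namespace IsRankedGap

variable {α : Type*} {k : ℕ} {r : α → Fin k} {T : α → α → Prop}

/-- The partial order given by ranks and gaps. -/
@[reducible]
def toPartialOrder (h : IsRankedGap r T) : PartialOrder α where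
  le a b := a = b ∨ (r a < r b ∧ ¬ T a b)
  le_refl a := Or.inl rfl
  le_trans a b c := by
    rintro (rfl | ⟨h1, h2⟩) (rfl | ⟨h3, h4⟩)
    · exact Or.inl rfl
    · exact Or.inr ⟨h3, h4⟩
    · exact Or.inr ⟨h1, h2⟩
    -- Two strict steps raise the rank by at least two, whereas `T` only relates adjacent ranks.
    · refine Or.inr ⟨h1.trans h3, fun h5 => ?_⟩
      have := h.adj _ _ h5
      simp only [Fin.lt_def] at h1 h3
      omega
  le_antisymm a b := by
    rintro (rfl | ⟨h1, -⟩) (h3 | ⟨h3, -⟩)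
    · rfl
    · rfl
    · exact h3.symm
    · exact absurd h1 h3.asymm

theorem lt_iff (h : IsRankedGap r T) {a b : α} :
    h.toPartialOrder.lt a b ↔ r a < r b ∧ ¬ T a b := by
  let _ := h.toPartialOrder
  change a < b ↔ _
  rw [lt_iff_le_and_ne]
  constructor
  · rintro ⟨h1 | h1, h2⟩
    · exact absurd h1 h2
    · exact h1
  · intro h1
    refine ⟨Or.inr h1, ?_⟩
    rintro rfl
    exact lt_irrefl _ h1.1

/-- In a violation the rank of `d` exceeds that of `a` by at most one, and likewise for `b` and `c`.
With `a < b` and `c < d` this forces `r a = r c`, so `T a d` and `T c b` hold; the Ferrers condition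
then yields `T a b` or `T c d`, a contradiction. -/
theorem isIntervalOrder (h : IsRankedGap r T) : @IsIntervalOrder α h.toPartialOrder := by
  let _ := h.toPartialOrder
  rw [isIntervalOrder_iff]
  intro a b c d hab hcd
  change h.toPartialOrder.lt _ _ at hab hcd
  rw [h.lt_iff] at hab hcd
  by_contra hn
  rw [not_or, h.lt_iff, h.lt_iff, not_and_not_right, not_and_not_right] at hn
  obtain ⟨h1, h2⟩ := hn
  have e1 : (r d : ℕ) ≤ r a + 1 := by
    by_cases h3 : r a < r d
    · exact (h.adj _ _ (h1 h3)).le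
    · simp only [Fin.lt_def] at h3; omega
  have e2 : (r b : ℕ) ≤ r c + 1 := by
    by_cases h3 : r c < r b
    · exact (h.adj _ _ (h2 h3)).le
    · simp only [Fin.lt_def] at h3; omega
  have e3 := Fin.lt_def.1 hab.1
  have e4 := Fin.lt_def.1 hcd.1
  have t1 := h1 (Fin.lt_def.2 (by omega))
  have t2 := h2 (Fin.lt_def.2 (by omega))
  rcases h.ferrers _ _ _ _ t1 t2 (Fin.ext (by omega)) with h3 | h3
  · exact hab.2 h3
  · exact hcd.2 h3

/-- Ranks are distinct along a chain, and a chain that misses a rank can be enlarged by an isolated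
vertex of that rank. -/
theorem ncard_of_isMaxChain (h : IsRankedGap r T) {s : Set α}
    (hs : IsMaxChain h.toPartialOrder.le s) : s.ncard = k := by
  let _ := h.toPartialOrder
  have hinj : Set.InjOn r s := by
    intro a ha b hb hab
    by_contra hne
    rcases hs.1 ha hb hne with (h1 | h1) | (h1 | h1)
    · exact hne h1
    · exact h1.1.ne hab
    · exact hne h1.symm
    · exact h1.1.ne hab.symm
  have himg : r '' s = Set.univ := by
    refine Set.eq_univ_of_forall fun i => ?_
    by_contra hi
    obtain ⟨v, hv, hT⟩ := h.exists_isolated i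
    have hchain : IsChain h.toPartialOrder.le (insert v s) := by
      refine hs.1.insert fun b hb _ => ?_
      have hne : r v ≠ r b := fun h' => hi ⟨b, hb, h'.symm.trans hv⟩
      rcases hne.lt_or_gt with h1 | h1
      · exact Or.inl (Or.inr ⟨h1, (hT b).1⟩)
      · exact Or.inr (Or.inr ⟨h1, (hT b).2⟩)
    have := hs.2 hchain (Set.subset_insert v s)
    exact hi ⟨v, this ▸ Set.mem_insert v s, hv⟩
  rw [← hinj.ncard_image, himg, Set.ncard_univ, Nat.card_fin]

theorem isGradedOfHeight (h : IsRankedGap r T) : @IsGradedOfHeight α h.toPartialOrder k :=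
  ⟨fun _ _ hs ht => (h.ncard_of_isMaxChain hs).trans (h.ncard_of_isMaxChain ht).symm,
    fun _ hs => h.ncard_of_isMaxChain hs⟩

/-- A chain through a given vertex that meets all the ranks. -/
theorem exists_strictMono_section (h : IsRankedGap r T) (x : α) :
    ∃ f : Fin k → α, f (r x) = x ∧
      ∀ i j, i < j → h.toPartialOrder.lt (f i) (f j) := by
  choose u hu hT using h.exists_isolated
  classical
  refine ⟨Function.update u (r x) x, Function.update_self .., fun i j hij => ?_⟩
  rw [lt_iff]
  by_cases hi : i = r x
  · subst hi
    rw [Function.update_self, Function.update_of_ne hij.ne', hu]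
    exact ⟨hij, (hT j x).2⟩
  · rw [Function.update_of_ne hi, hu]
    refine ⟨?_, (hT i _).1⟩
    by_cases hj : j = r x
    · subst hj
      rwa [Function.update_self]
    · rwa [Function.update_of_ne hj, hu]

/-- A chain through `x` meeting all ranks of `r` has strictly increasing ranks under `r'`, and the
identity is the only strictly increasing self-map of `Fin k`. -/
theorem rank_eq_of_toPartialOrder_eq (h : IsRankedGap r T) {r' : α → Fin k} {T' : α → α → Prop}
    (h' : IsRankedGap r' T') (heq : h.toPartialOrder = h'.toPartialOrder) : r = r' := by
  funext x
  obtain ⟨f, hf, hlt⟩ := h.exists_strictMono_section x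
  have hmono : StrictMono fun i => r' (f i) := by
    intro i j hij
    have := hlt i j hij
    rw [heq, lt_iff] at this
    exact this.1
  have := congrFun (congrArg DFunLike.coe (Subsingleton.elim
    (OrderIso.refl (Fin k)) (StrictMono.orderIsoOfSurjective _ hmono
      (Finite.surjective_of_injective hmono.injective)))) (r x)
  simpa [hf] using this

theorem gap_iff (h : IsRankedGap r T) (a b : α) :
    T a b ↔ (r b : ℕ) = r a + 1 ∧ ¬ h.toPartialOrder.lt a b := by
  rw [lt_iff]
  constructor
  · intro hT
    exact ⟨h.adj _ _ hT, fun h' => h'.2 hT⟩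
  · rintro ⟨h1, h2⟩
    by_contra hT
    exact h2 ⟨Fin.lt_def.2 (by omega), hT⟩

theorem gap_eq_of_toPartialOrder_eq (h : IsRankedGap r T) {T' : α → α → Prop}
    (h' : IsRankedGap r T') (heq : h.toPartialOrder = h'.toPartialOrder) : T = T' := by
  funext a b
  rw [eq_iff_iff, h.gap_iff, h'.gap_iff, heq]

end IsRankedGap

/-! ### From a graded interval order to ranks and gaps -/

section Graded

variable {α : Type*} [PartialOrder α] {k : ℕ}

/-- The rank is `Order.height`; it stays below `k` because every chain extends to a maximal one,
which has `k` elements. -/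
theorem exists_strictMono_of_isGradedOfHeight [Finite α] (h : IsGradedOfHeight α k) :
    ∃ r : α → Fin k, StrictMono r := by
  have hlt : ∀ p : LTSeries α, p.length < k := by
    intro p
    have hc : IsChain (· ≤ ·) (Set.range p) := by
      rintro _ ⟨i, rfl⟩ _ ⟨j, rfl⟩ _
      rcases le_total i j with hij | hij
      · exact Or.inl (p.strictMono.monotone hij)
      · exact Or.inr (p.strictMono.monotone hij)
    obtain ⟨s, hs, hsub⟩ := hc.exists_maxChain
    rw [← h.2 s hs, Nat.lt_iff_add_one_le]
    refine le_trans ?_ (Set.ncard_le_ncard hsub (Set.toFinite s))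
    rw [← Set.image_univ, Set.ncard_image_of_injective _ p.strictMono.injective, Set.ncard_univ,
      Nat.card_fin]
  have hle : ∀ x : α, Order.height x < k := by
    intro x
    have hk : 0 < k := (Nat.zero_le _).trans_lt (hlt (RelSeries.singleton _ x))
    refine lt_of_le_of_lt (b := ((k - 1 : ℕ) : ℕ∞))
      (Order.height_le fun p _ => ?_) (by exact_mod_cast Nat.sub_lt hk one_pos)
    have := hlt p
    exact_mod_cast (by omega : p.length ≤ k - 1)
  refine ⟨fun x => ⟨(Order.height x).toNat, ?_⟩, fun x y hxy => ?_⟩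
  · have := hle x
    rw [← ENat.natCast_toNat (this.trans_le le_top).ne] at this
    exact_mod_cast this
  · have h1 := Order.height_strictMono hxy ((hle x).trans_le le_top)
    rw [← ENat.natCast_toNat ((hle x).trans_le le_top).ne,
      ← ENat.natCast_toNat ((hle y).trans_le le_top).ne] at h1
    exact Fin.lt_def.2 (by exact_mod_cast h1)

variable {r : α → Fin k}

/-- Each chain of a graded poset can be extended by an element of any given rank. -/
theorem IsGradedOfHeight.exists_rank_eq (h : IsGradedOfHeight α k) (hr : StrictMono r) {s : Set α}
    (hs : IsChain (· ≤ ·) s) (i : Fin k) :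
    ∃ b, r b = i ∧ ∀ x ∈ s, (r x < i → x < b) ∧ (i < r x → b < x) := by
  obtain ⟨t, ht, hst⟩ := hs.exists_maxChain
  have hinj : Set.InjOn r t := by
    intro a ha b hb hab
    by_contra hne
    rcases ht.1 ha hb hne with h1 | h1
    · exact (hr (lt_of_le_of_ne h1 hne)).ne hab
    · exact (hr (lt_of_le_of_ne h1 (Ne.symm hne))).ne hab.symm
  -- A maximal chain has `k` elements of distinct ranks among `k` ranks, so it meets each rank.
  have himg : r '' t = Set.univ := by
    refine Set.eq_of_subset_of_ncard_le (Set.subset_univ _) ?_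
    rw [hinj.ncard_image, h.2 t ht, Set.ncard_univ, Nat.card_fin]
  obtain ⟨b, hb, rfl⟩ := himg.symm ▸ Set.mem_univ i
  refine ⟨b, rfl, fun x hx => ⟨fun hlt => ?_, fun hlt => ?_⟩⟩
  · have hne : x ≠ b := by rintro rfl; exact hlt.false
    rcases ht.1 (hst hx) hb hne with h1 | h1
    · exact lt_of_le_of_ne h1 hne
    · exact absurd (hr.monotone h1) (not_le.2 hlt)
  · have hne : x ≠ b := by rintro rfl; exact hlt.false
    rcases ht.1 (hst hx) hb hne with h1 | h1
    · exact absurd (hr.monotone h1) (not_le.2 hlt)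
    · exact lt_of_le_of_ne h1 hne.symm

/-- Take `b > a` one rank above `a` and `d < c` one rank below `c`. Avoiding `2 + 2` leaves `a < c`
or `d < b`, and the latter fails since `d` has at least the rank of `b`. -/
theorem IsGradedOfHeight.lt_of_rank_add_two_le (h : IsGradedOfHeight α k) (hi : IsIntervalOrder α)
    (hr : StrictMono r) {a c : α} (hac : (r a : ℕ) + 2 ≤ r c) : a < c := by
  rw [isIntervalOrder_iff] at hi
  have hk := (r c).2
  obtain ⟨b, hb, hb'⟩ := h.exists_rank_eq hr (Set.subsingleton_singleton (a := a)).isChain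
    ⟨r a + 1, by omega⟩
  obtain ⟨d, hd, hd'⟩ := h.exists_rank_eq hr (Set.subsingleton_singleton (a := c)).isChain
    ⟨r c - 1, by omega⟩
  have h1 : a < b := (hb' a rfl).1 (Fin.lt_def.2 (by simp))
  have h2 : d < c := (hd' c rfl).2 (Fin.lt_def.2 (by simp; omega))
  rcases hi a b d c h1 h2 with h3 | h3
  · exact h3
  · have := hr h3
    rw [hb, hd, Fin.lt_def] at this
    simp only at this
    omega

/-- In an interval order the strict up-sets of elements are nested; `a` has the smallest one in `s`.
-/
theorem exists_forall_lt_of_isIntervalOrder [Finite α] (hi : IsIntervalOrder α) {s : Set α}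
    (hs : s.Nonempty) : ∃ a ∈ s, ∀ b, a < b → ∀ a' ∈ s, a' < b := by
  rw [isIntervalOrder_iff] at hi
  obtain ⟨a, ha, hmin⟩ := Set.exists_min_image s (fun a => (Set.Ioi a).ncard) (Set.toFinite s) hs
  refine ⟨a, ha, fun b hab a' ha' => ?_⟩
  by_contra hn
  refine (hmin a' ha').not_gt (Set.ncard_lt_ncard ⟨fun c hc => ?_, fun hsub => hn (hsub hab)⟩
    (Set.toFinite _))
  exact (hi a b a' c hab hc).resolve_right hn

theorem exists_forall_gt_of_isIntervalOrder [Finite α] (hi : IsIntervalOrder α) {s : Set α}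
    (hs : s.Nonempty) : ∃ a ∈ s, ∀ b, b < a → ∀ a' ∈ s, b < a' := by
  rw [isIntervalOrder_iff] at hi
  obtain ⟨a, ha, hmin⟩ := Set.exists_min_image s (fun a => (Set.Iio a).ncard) (Set.toFinite s) hs
  refine ⟨a, ha, fun b hab a' ha' => ?_⟩
  by_contra hn
  refine (hmin a' ha').not_gt (Set.ncard_lt_ncard ⟨fun c hc => ?_, fun hsub => hn (hsub hab)⟩
    (Set.toFinite _))
  exact (hi b a c a' hab hc).resolve_left hn

/-- Choose `a` in the rank below with the smallest up-set and `c` in the rank above with the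
smallest down-set. Their ranks differ by two, so they form a chain, and an element of rank `i`
between them is comparable with both adjacent ranks entirely. For an extreme rank one of the two is
absent. -/
theorem IsGradedOfHeight.exists_universal [Finite α] (h : IsGradedOfHeight α k)
    (hi : IsIntervalOrder α) (hr : StrictMono r) (i : Fin k) :
    ∃ v, r v = i ∧ (∀ a, (r a : ℕ) + 1 = i → a < v) ∧ ∀ c, (r c : ℕ) = i + 1 → v < c := by
  have key : ∃ s : Set α, IsChain (· ≤ ·) s ∧
      ((∀ a, (r a : ℕ) + 1 ≠ i) ∨ ∃ a ∈ s, (r a : ℕ) + 1 = i ∧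
        ∀ b, a < b → ∀ a' ∈ {a | (r a : ℕ) + 1 = i}, a' < b) ∧
      ((∀ c, (r c : ℕ) ≠ i + 1) ∨ ∃ c ∈ s, (r c : ℕ) = i + 1 ∧
        ∀ b, b < c → ∀ c' ∈ {c | (r c : ℕ) = i + 1}, b < c') := by
    rcases Set.eq_empty_or_nonempty {a | (r a : ℕ) + 1 = i} with h1 | h1 <;>
      rcases Set.eq_empty_or_nonempty {c | (r c : ℕ) = i + 1} with h2 | h2
    · exact ⟨∅, IsChain.empty, Or.inl (Set.eq_empty_iff_forall_notMem.1 h1),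
        Or.inl (Set.eq_empty_iff_forall_notMem.1 h2)⟩
    · obtain ⟨c, hc, hc'⟩ := exists_forall_gt_of_isIntervalOrder hi h2
      exact ⟨{c}, Set.subsingleton_singleton.isChain,
        Or.inl (Set.eq_empty_iff_forall_notMem.1 h1), Or.inr ⟨c, rfl, hc, hc'⟩⟩
    · obtain ⟨a, ha, ha'⟩ := exists_forall_lt_of_isIntervalOrder hi h1
      exact ⟨{a}, Set.subsingleton_singleton.isChain, Or.inr ⟨a, rfl, ha, ha'⟩,
        Or.inl (Set.eq_empty_iff_forall_notMem.1 h2)⟩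
    · obtain ⟨a, ha, ha'⟩ := exists_forall_lt_of_isIntervalOrder hi h1
      obtain ⟨c, hc, hc'⟩ := exists_forall_gt_of_isIntervalOrder hi h2
      refine ⟨{a, c}, IsChain.pair (h.lt_of_rank_add_two_le hi hr ?_).le,
        Or.inr ⟨a, by simp, ha, ha'⟩, Or.inr ⟨c, by simp, hc, hc'⟩⟩
      simp only [Set.mem_ofPred_eq] at ha hc
      omega
  obtain ⟨s, hs, hA, hC⟩ := key
  obtain ⟨b, hb, hb'⟩ := h.exists_rank_eq hr hs i
  refine ⟨b, hb, fun a ha => ?_, fun c hc => ?_⟩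
  · rcases hA with hA | ⟨a₀, ha₀, hra, hA⟩
    · exact absurd ha (hA a)
    · exact hA b ((hb' a₀ ha₀).1 (Fin.lt_def.2 (by omega))) a ha
  · rcases hC with hC | ⟨c₀, hc₀, hrc, hC⟩
    · exact absurd hc (hC c)
    · exact hC b ((hb' c₀ hc₀).2 (Fin.lt_def.2 (by omega))) c hc

theorem IsGradedOfHeight.lt_iff_rank (h : IsGradedOfHeight α k) (hi : IsIntervalOrder α)
    (hr : StrictMono r) (a b : α) :
    a < b ↔ r a < r b ∧ ¬ ((r b : ℕ) = r a + 1 ∧ ¬ a < b) := by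
  constructor
  · exact fun hab => ⟨hr hab, fun h' => h'.2 hab⟩
  · rintro ⟨h1, h2⟩
    by_contra hn
    refine hn (h.lt_of_rank_add_two_le hi hr ?_)
    have : ¬ (r b : ℕ) = r a + 1 := fun h3 => h2 ⟨h3, hn⟩
    have := Fin.lt_def.1 h1
    omega

theorem IsGradedOfHeight.isRankedGap [Finite α] (h : IsGradedOfHeight α k)
    (hi : IsIntervalOrder α) (hr : StrictMono r) :
    IsRankedGap r fun a b => (r b : ℕ) = r a + 1 ∧ ¬ a < b where
  adj a b hab := hab.1
  ferrers a b a' b' hab hab' haa := by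
    by_contra! hn
    have h1 := hn.1 (by rw [hab'.1, haa])
    have h2 := hn.2 (by rw [hab.1, haa])
    rcases isIntervalOrder_iff.1 hi _ _ _ _ h1 h2 with h3 | h3
    · exact hab.2 h3
    · exact hab'.2 h3
  exists_isolated i := by
    obtain ⟨v, hv, hA, hC⟩ := h.exists_universal hi hr i
    refine ⟨v, hv, fun w => ⟨fun h' => h'.2 (hC w ?_), fun h' => h'.2 (hA w ?_)⟩⟩
    · rw [h'.1, hv]
    · rw [← h'.1, hv]

end Graded

theorem ncard_graded_eq_card_rankedGap (α : Type*) [Finite α] (k : ℕ) :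
    {P : PartialOrder α | @IsIntervalOrder α P ∧ @IsGradedOfHeight α P k}.ncard =
      Nat.card {p : (α → Fin k) × (α → α → Prop) // IsRankedGap p.1 p.2} := by
  symm
  refine Nat.card_eq_of_bijective (fun p => ⟨p.2.toPartialOrder, p.2.isIntervalOrder,
    p.2.isGradedOfHeight⟩) ⟨?_, ?_⟩
  · rintro ⟨⟨r, T⟩, h⟩ ⟨⟨r', T'⟩, h'⟩ heq
    have heq : h.toPartialOrder = h'.toPartialOrder := congrArg Subtype.val heq
    have e1 : r = r' := h.rank_eq_of_toPartialOrder_eq h' heq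
    subst e1
    have e2 : T = T' := h.gap_eq_of_toPartialOrder_eq h' heq
    subst e2
    rfl
  · rintro ⟨P, hi, hg⟩
    obtain ⟨r, hr⟩ := exists_strictMono_of_isGradedOfHeight hg
    refine ⟨⟨(r, _), hg.isRankedGap hi hr⟩, Subtype.ext (PartialOrder.ext_lt fun a b => ?_)⟩
    exact (hg.isRankedGap hi hr).lt_iff.trans (hg.lt_iff_rank hi hr a b).symm

/-! ### Counting surjections and Ferrers relations -/

/-- Remove the first value `a`: the remaining map is either still onto, or onto the complement of
`a`. This matches the Stirling recurrence. -/
theorem card_surjective_fin (n : ℕ) (β : Type) [Fintype β] :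
    Nat.card {f : Fin n → β // Function.Surjective f} =
      (Fintype.card β)! * Nat.stirlingSecond n (Fintype.card β) := by
  classical
  induction n generalizing β with
  | zero =>
    rcases h : Fintype.card β with _ | m
    · have := Fintype.card_eq_zero_iff.1 h
      have : Nonempty {f : Fin 0 → β // Function.Surjective f} := ⟨⟨Fin.elim0, isEmptyElim⟩⟩
      rw [Nat.card_unique]
      simp
    · have : Nonempty β := Fintype.card_pos_iff.1 (by omega)
      have : IsEmpty {f : Fin 0 → β // Function.Surjective f} :=
        ⟨fun f => (f.2 (Classical.arbitrary β)).elim fun i _ => i.elim0⟩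
      simp
  | succ n ih =>
    let e : (Σ a : β, {t : Fin n → β // Function.Surjective t} ⊕
        {t : Fin n → {x // x ≠ a} // Function.Surjective t}) →
        {f : Fin (n + 1) → β // Function.Surjective f} := fun p => match p with
      | ⟨a, .inl t⟩ => ⟨Fin.cons a t.1, fun b => by
          obtain ⟨i, hi⟩ := t.2 b
          exact ⟨i.succ, by simpa using hi⟩⟩
      | ⟨a, .inr t⟩ => ⟨Fin.cons a fun i => (t.1 i : β), fun b => by
          by_cases hb : b = a
          · exact ⟨0, by simp [hb]⟩
          · obtain ⟨i, hi⟩ := t.2 ⟨b, hb⟩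
            exact ⟨i.succ, by simp [hi]⟩⟩
    have he : Function.Bijective e := by
      constructor
      · rintro ⟨a, ⟨t, ht⟩ | ⟨t, ht⟩⟩ ⟨b, ⟨s, hs⟩ | ⟨s, hs⟩⟩ h <;>
          replace h := congrArg Subtype.val h <;>
          obtain rfl : a = b := congrFun h 0
        · have : t = s := funext fun i => congrFun h i.succ
          subst this
          rfl
        · obtain ⟨i, hi⟩ := ht a
          exact absurd ((congrFun h i.succ).symm.trans hi) (s i).2
        · obtain ⟨i, hi⟩ := hs a
          exact absurd ((congrFun h i.succ).trans hi) (t i).2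
        · have : t = s := funext fun i => Subtype.ext (congrFun h i.succ)
          subst this
          rfl
      · rintro ⟨f, hf⟩
        by_cases h : Function.Surjective (Fin.tail f)
        · exact ⟨⟨f 0, .inl ⟨_, h⟩⟩, Subtype.ext (Fin.cons_self_tail f)⟩
        · have h0 : ∀ b, b ≠ f 0 → ∃ i, Fin.tail f i = b := by
            intro b hb
            obtain ⟨i, rfl⟩ := hf b
            exact ⟨i.pred (by rintro rfl; exact hb rfl), by simp [Fin.tail]⟩
          have h1 : ∀ i, Fin.tail f i ≠ f 0 := by
            intro i hi
            refine h fun b => ?_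
            by_cases hb : b = f 0
            · exact ⟨i, hi.trans hb.symm⟩
            · exact h0 b hb
          refine ⟨⟨f 0, .inr ⟨fun i => ⟨Fin.tail f i, h1 i⟩, fun b => ?_⟩⟩,
            Subtype.ext (Fin.cons_self_tail f)⟩
          obtain ⟨i, hi⟩ := h0 b.1 b.2
          exact ⟨i, Subtype.ext hi⟩
    rw [← Nat.card_eq_of_bijective e he, Nat.card_sigma]
    simp only [Nat.card_sum, ih, Fintype.card_subtype_compl, Fintype.card_unique]
    rw [Finset.sum_const, Finset.card_univ, smul_eq_mul]
    rcases Fintype.card β with _ | m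
    · simp
    · rw [Nat.stirlingSecond_succ_succ, Nat.factorial_succ, Nat.add_sub_cancel]
      ring

theorem card_surjective {α : Type} [Finite α] (j : ℕ) :
    Nat.card {f : α → Fin j // Function.Surjective f} =
      j ! * Nat.stirlingSecond (Nat.card α) j := by
  have h := card_surjective_fin (Nat.card α) (Fin j)
  rw [Fintype.card_fin] at h
  rw [← h]
  refine Nat.card_congr (Equiv.subtypeEquiv
    (Equiv.arrowCongr (Finite.equivFin α) (Equiv.refl _)) fun f => ?_)
  simp [Equiv.arrowCongr]

/-- A relation between two sets whose neighbourhoods form a chain of nonempty sets that cover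
everything. -/
structure IsFerrers {X Y : Type*} (R : X → Y → Prop) : Prop where
  chain : ∀ x y x' y', R x y → R x' y' → R x y' ∨ R x' y
  exists_right : ∀ x, ∃ y, R x y
  exists_left : ∀ y, ∃ x, R x y

section Ferrers

variable {X Y : Type}

theorem isFerrers_of_surjective {j : ℕ} {f : X → Fin j} {g : Y → Fin j}
    (hf : Function.Surjective f) (hg : Function.Surjective g) :
    IsFerrers fun x y => f x ≤ g y where
  chain x y x' y' h h' := by
    rcases le_total (g y) (g y') with h1 | h1
    · exact Or.inl (h.trans h1)
    · exact Or.inr (h'.trans h1)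
  exists_right x := (hg (f x)).imp fun _ h => h.ge
  exists_left y := (hf (g y)).imp fun _ h => h.le

theorem le_iff_le_of_forall_le_iff {j j' : ℕ} {f : X → Fin j} {g : Y → Fin j} {f' : X → Fin j'}
    {g' : Y → Fin j'} (hg : Function.Surjective g) (h : ∀ x y, f x ≤ g y ↔ f' x ≤ g' y) {x x' : X}
    (hx : f' x ≤ f' x') : f x ≤ f x' := by
  obtain ⟨y, hy⟩ := hg (f x')
  rw [← hy, h]
  exact hx.trans ((h x' y).1 hy.ge)

/-- The relation determines the preorder that `f` induces on `X`, and a surjection onto an initial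
segment is determined by its preorder. The level of `y` is then the highest level of its neighbours.
-/
theorem ferrers_levels_unique {j j' : ℕ} {f : X → Fin j} {g : Y → Fin j} {f' : X → Fin j'}
    {g' : Y → Fin j'} (hf : Function.Surjective f) (hg : Function.Surjective g)
    (hf' : Function.Surjective f') (hg' : Function.Surjective g')
    (h : ∀ x y, f x ≤ g y ↔ f' x ≤ g' y) :
    ∃ e : j = j', (∀ x, Fin.cast e (f x) = f' x) ∧ ∀ y, Fin.cast e (g y) = g' y := by
  have hle : ∀ x x', f x ≤ f x' ↔ f' x ≤ f' x' := fun x x' =>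
    ⟨le_iff_le_of_forall_le_iff hg' fun x y => (h x y).symm, le_iff_le_of_forall_le_iff hg h⟩
  obtain ⟨s, hs⟩ := hf.hasRightInverse
  have hfs : ∀ x, f' (s (f x)) = f' x := fun x =>
    le_antisymm ((hle _ _).1 (hs _).le) ((hle _ _).1 (hs _).ge)
  have hmono : StrictMono fun i => f' (s i) := by
    intro a b hab
    refine lt_of_not_ge fun hba => ?_
    have := (hle _ _).2 hba
    rw [hs, hs] at this
    exact absurd hab (not_lt.2 this)
  have hsurj : Function.Surjective fun i => f' (s i) := by
    intro b
    obtain ⟨x, rfl⟩ := hf' b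
    exact ⟨f x, hfs x⟩
  have e : j = j' := by
    simpa using Fintype.card_congr (StrictMono.orderIsoOfSurjective _ hmono hsurj).toEquiv
  subst e
  have hff : f = f' := by
    funext x
    have := congrFun (congrArg DFunLike.coe (Subsingleton.elim
      (OrderIso.refl (Fin j)) (StrictMono.orderIsoOfSurjective _ hmono hsurj))) (f x)
    simpa [hfs] using this
  subst hff
  refine ⟨rfl, fun x => rfl, fun y => ?_⟩
  refine le_antisymm ?_ ?_
  · obtain ⟨x, hx⟩ := hf (g y)
    exact hx ▸ (h x y).1 hx.le
  · obtain ⟨x, hx⟩ := hf (g' y)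
    exact hx ▸ (h x y).2 hx.le

theorem IsFerrers.exists_levels [Finite X] {R : X → Y → Prop} (hR : IsFerrers R) :
    ∃ (j : ℕ) (f : X → Fin j) (g : Y → Fin j), Function.Surjective f ∧ Function.Surjective g ∧
      ∀ x y, R x y ↔ f x ≤ g y := by
  classical
  -- Reverse inclusion, so that low levels have large neighbourhoods; the level of `x` is the
  -- position of `N x` in this chain.
  let N : X → (Set Y)ᵒᵈ := fun x => OrderDual.toDual {y | R x y}
  have hN : ∀ {x x' : X}, N x ≤ N x' ↔ ∀ y, R x' y → R x y := Iff.rfl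
  have htot : ∀ a b : Set.range N, a ≤ b ∨ b ≤ a := by
    rintro ⟨_, x, rfl⟩ ⟨_, x', rfl⟩
    change N x ≤ N x' ∨ N x' ≤ N x
    rw [hN, hN]
    by_contra! hn
    obtain ⟨⟨y, hy, hy'⟩, z, hz, hz'⟩ := hn
    rcases hR.chain _ _ _ _ hy hz with h | h
    · exact hz' h
    · exact hy' h
  let _ : LinearOrder (Set.range N) :=
    { (inferInstance : PartialOrder (Set.range N)) with
      le_total := htot
      toDecidableLE := Classical.decRel _ }
  have : Fintype (Set.range N) := Fintype.ofFinite _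
  let e : Fin (Fintype.card (Set.range N)) ≃o Set.range N := Fintype.orderIsoFinOfCardEq _ rfl
  let f : X → Fin (Fintype.card (Set.range N)) := fun x => e.symm ⟨N x, x, rfl⟩
  have hf : ∀ {x x'}, f x ≤ f x' ↔ ∀ y, R x' y → R x y := fun {x x'} => e.symm.le_iff_le
  have hsurj : Function.Surjective f := by
    intro i
    obtain ⟨x, hx⟩ := (e i).2
    refine ⟨x, ?_⟩
    rw [OrderIso.symm_apply_eq]
    exact Subtype.ext hx
  have hmax : ∀ y, ∃ x, R x y ∧ ∀ x', R x' y → f x' ≤ f x := fun y =>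
    Set.exists_max_image {x | R x y} f (Set.toFinite _) (hR.exists_left y)
  choose m hm hm' using hmax
  have key : ∀ x y, R x y ↔ f x ≤ f (m y) := fun x y => ⟨hm' y x, fun h => hf.1 h y (hm y)⟩
  refine ⟨_, f, fun y => f (m y), hsurj, fun i => ?_, key⟩
  obtain ⟨x, hx⟩ := hsurj i
  -- Level `i` is attained on `Y`: some `y` is a neighbour at level `i` but not at the next level,
  -- where neighbourhoods are strictly smaller. At the top level any neighbour will do.
  by_cases hi : ∃ i', i < i'
  · obtain ⟨i', hi', hmin⟩ := Set.exists_min_image {i' | i < i'} id (Set.toFinite _) hi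
    obtain ⟨x', rfl⟩ := hsurj i'
    have h1 : ¬ f x' ≤ f x := by rw [hx]; exact not_le.2 hi'
    rw [hf] at h1
    push Not at h1
    obtain ⟨y, hy, hy'⟩ := h1
    rw [key] at hy hy'
    refine ⟨y, le_antisymm (not_lt.1 fun h => hy' (hmin _ h)) (hx ▸ hy)⟩
  · obtain ⟨y, hy⟩ := hR.exists_right x
    rw [key, hx] at hy
    exact ⟨y, le_antisymm (not_lt.1 fun h => hi ⟨_, h⟩) hy⟩

theorem card_isFerrers [Finite X] [Finite Y] :
    Nat.card {R : X → Y → Prop // IsFerrers R} = psiTwoTwo (Nat.card Y) (Nat.card X) := by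
  have h : Function.Bijective fun p : Σ j : Fin (Nat.card X + 1),
      {f : X → Fin j // Function.Surjective f} × {g : Y → Fin j // Function.Surjective g} =>
      (⟨fun x y => p.2.1.1 x ≤ p.2.2.1 y, isFerrers_of_surjective p.2.1.2 p.2.2.2⟩ :
        {R : X → Y → Prop // IsFerrers R}) := by
    constructor
    · rintro ⟨⟨j, hj⟩, ⟨f, hf⟩, g, hg⟩ ⟨⟨j', hj'⟩, ⟨f', hf'⟩, g', hg'⟩ heq
      simp only [Subtype.mk.injEq] at heq f g f' g'
      obtain ⟨e, h1, h2⟩ := ferrers_levels_unique hf hg hf' hg' fun x y =>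
        iff_of_eq (congrFun (congrFun heq x) y)
      subst e
      have e1 : f = f' := funext h1
      have e2 : g = g' := funext h2
      subst e1 e2
      rfl
    · rintro ⟨R, hR⟩
      obtain ⟨j, f, g, hf, hg, h⟩ := hR.exists_levels
      have hj : j ≤ Nat.card X := by
        simpa using Nat.card_le_card_of_surjective f hf
      refine ⟨⟨⟨j, Nat.lt_succ_of_le hj⟩, ⟨f, hf⟩, ⟨g, hg⟩⟩, Subtype.ext ?_⟩
      funext x y
      exact propext (h x y).symm
  rw [← Nat.card_eq_of_bijective _ h, Nat.card_sigma]
  simp only [Nat.card_prod, card_surjective]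
  rw [Fin.sum_univ_eq_sum_range fun j => j ! * Nat.stirlingSecond (Nat.card X) j *
    (j ! * Nat.stirlingSecond (Nat.card Y) j)]
  exact Finset.sum_congr rfl fun j _ => by ring

end Ferrers

/-! ### Colourings by rank and universality -/

section Colour

variable {α : Type} {k : ℕ}

/-- The vertices just below the `g`-th gap between ranks that have an incomparable vertex just
above the gap, according to the colouring `c`. -/
abbrev LowerGap (c : α → Fin k × Bool × Bool) (g : Fin (k + 1)) : Type :=
  {v // (c v).1.succ = g ∧ (c v).2.2 = true}

/-- The vertices just above the `g`-th gap between ranks that have an incomparable vertex just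
below the gap, according to the colouring `c`. -/
abbrev UpperGap (c : α → Fin k × Bool × Bool) (g : Fin (k + 1)) : Type :=
  {v // (c v).1.castSucc = g ∧ (c v).2.1 = true}

/-- The colour of a vertex records its rank, and whether it is in the gap relation with some vertex
of the rank below and of the rank above. -/
noncomputable def gapColour (r : α → Fin k) (T : α → α → Prop) (v : α) : Fin k × Bool × Bool :=
  open Classical in (r v, decide (∃ w, T w v), decide (∃ w, T v w))

/-- The gap relation assembled from its restrictions to the gaps between adjacent ranks. -/
def assembledGap (c : α → Fin k × Bool × Bool)
    (R : ∀ g, LowerGap c g → UpperGap c g → Prop) (a b : α) : Prop :=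
  ∃ g ha hb, R g ⟨a, ha⟩ ⟨b, hb⟩

variable {c : α → Fin k × Bool × Bool} {R : ∀ g, LowerGap c g → UpperGap c g → Prop}

theorem assembledGap_iff {g : Fin (k + 1)} (a : LowerGap c g) (b : UpperGap c g) :
    assembledGap c R a b ↔ R g a b := by
  constructor
  · rintro ⟨g', ha, hb, h⟩
    obtain rfl : g = g' := a.2.1.symm.trans ha.1
    exact h
  · exact fun h => ⟨g, a.2, b.2, h⟩

theorem exists_assembledGap_left (hR : ∀ g, IsFerrers (R g)) (v : α) :
    (∃ w, assembledGap c R w v) ↔ (c v).2.1 = true := by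
  constructor
  · rintro ⟨w, g, ha, hb, -⟩
    exact hb.2
  · intro h
    obtain ⟨w, hw⟩ := (hR _).exists_left ⟨v, rfl, h⟩
    exact ⟨w, _, w.2, ⟨rfl, h⟩, hw⟩

theorem exists_assembledGap_right (hR : ∀ g, IsFerrers (R g)) (v : α) :
    (∃ w, assembledGap c R v w) ↔ (c v).2.2 = true := by
  constructor
  · rintro ⟨w, g, ha, hb, -⟩
    exact ha.2
  · intro h
    obtain ⟨w, hw⟩ := (hR _).exists_right ⟨v, rfl, h⟩
    exact ⟨w, _, ⟨rfl, h⟩, w.2, hw⟩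

/-- The colouring can be read off because no vertex is isolated in its `R g`. -/
theorem gapColour_assembledGap (hR : ∀ g, IsFerrers (R g)) :
    gapColour (fun v => (c v).1) (assembledGap c R) = c := by
  funext v
  simp only [gapColour, exists_assembledGap_left hR, exists_assembledGap_right hR,
    Bool.decide_eq_true]

theorem isRankedGap_assembledGap (hR : ∀ g, IsFerrers (R g))
    (hc : ∀ i, ∃ v, c v = (i, false, false)) :
    IsRankedGap (fun v => (c v).1) (assembledGap c R) where
  adj a b := by
    rintro ⟨g, ha, hb, -⟩
    have := congrArg Fin.val (hb.1.trans ha.1.symm)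
    simpa using this
  ferrers a b a' b' := by
    rintro ⟨g, ha, hb, h⟩ ⟨g', ha', hb', h'⟩ heq
    obtain rfl : g = g' := by rw [← ha.1, ← ha'.1]; exact congrArg Fin.succ heq
    rcases (hR g).chain _ _ _ _ h h' with h1 | h1
    · exact Or.inl ⟨g, _, _, h1⟩
    · exact Or.inr ⟨g, _, _, h1⟩
  exists_isolated i := by
    obtain ⟨v, hv⟩ := hc i
    refine ⟨v, by simp [hv], fun w => ⟨fun h => ?_, fun h => ?_⟩⟩
    · have := (exists_assembledGap_right hR v).1 ⟨w, h⟩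
      simp [hv] at this
    · have := (exists_assembledGap_left hR v).1 ⟨w, h⟩
      simp [hv] at this

variable {r : α → Fin k} {T : α → α → Prop}

theorem IsRankedGap.exists_gapColour_eq (h : IsRankedGap r T) (i : Fin k) :
    ∃ v, gapColour r T v = (i, false, false) := by
  obtain ⟨v, hv, hT⟩ := h.exists_isolated i
  refine ⟨v, ?_⟩
  simp [gapColour, hv, fun w => (hT w).1, fun w => (hT w).2]

theorem IsRankedGap.isFerrers (h : IsRankedGap r T) (g : Fin (k + 1)) :
    IsFerrers fun (x : LowerGap (gapColour r T) g) (y : UpperGap (gapColour r T) g) =>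
      T x y where
  chain x y x' y' hxy hxy' := h.ferrers _ _ _ _ hxy hxy'
    (Fin.succ_injective _ (x.2.1.trans x'.2.1.symm))
  exists_right x := by
    obtain ⟨w, hw⟩ : ∃ w, T x w := by simpa [gapColour] using x.2.2
    refine ⟨⟨w, ?_, ?_⟩, hw⟩
    · rw [← x.2.1]
      exact Fin.ext (by simpa [gapColour] using h.adj _ _ hw)
    · simpa [gapColour] using ⟨x.1, hw⟩
  exists_left y := by
    obtain ⟨w, hw⟩ : ∃ w, T w y := by simpa [gapColour] using y.2.2
    refine ⟨⟨w, ?_, ?_⟩, hw⟩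
    · rw [← y.2.1]
      exact Fin.ext (by simpa [gapColour] using (h.adj _ _ hw).symm)
    · simpa [gapColour] using ⟨y.1, hw⟩

theorem IsRankedGap.assembledGap_eq (h : IsRankedGap r T) :
    assembledGap (gapColour r T) (fun _ x y => T x y) = T := by
  funext a b
  refine propext ⟨fun ⟨_, _, _, h'⟩ => h', fun hT => ?_⟩
  refine ⟨(r b).castSucc, ⟨?_, ?_⟩, ⟨rfl, ?_⟩, hT⟩
  · exact Fin.ext (by simpa [gapColour] using (h.adj _ _ hT).symm)
  · simpa [gapColour] using ⟨b, hT⟩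
  · simpa [gapColour] using ⟨a, hT⟩

/-- The number of gap relations with a given colouring, in terms of the number of vertices of each
colour. -/
noncomputable def gapWeight {k : ℕ} (s : Fin k × Bool × Bool → ℕ) : ℕ :=
  open Classical in
  if ∀ i, s (i, false, false) ≠ 0 then
    ∏ g : Fin (k + 1),
      psiTwoTwo (∑ κ with κ.1.castSucc = g ∧ κ.2.1 = true, s κ)
        (∑ κ with κ.1.succ = g ∧ κ.2.2 = true, s κ)
  else 0

/-- The number of vertices of a given colour. -/
noncomputable def colourCount {α K : Type} (c : α → K) (κ : K) : ℕ := Nat.card {v // c v = κ}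

theorem card_subtype_eq_sum_colourCount {α K : Type} [Finite α] [Fintype K] (c : α → K)
    (P : K → Prop) [DecidablePred P] :
    Nat.card {v // P (c v)} = ∑ κ with P κ, colourCount c κ := by
  classical
  have := Fintype.ofFinite α
  simp only [colourCount, Nat.card_eq_fintype_card, Fintype.card_subtype]
  rw [Finset.card_eq_sum_card_fiberwise (f := c) (t := Finset.univ.filter P)]
  · refine Finset.sum_congr rfl fun κ hκ => ?_
    congr 1
    ext v
    simp only [Finset.mem_filter, Finset.mem_univ, true_and] at hκ ⊢
    exact ⟨fun h => h.2, fun h => ⟨h ▸ hκ, h⟩⟩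
  · intro v hv
    simpa using hv

/-- For a fixed colouring the relations on the `k + 1` gaps are chosen independently. The gaps below
the lowest and above the highest rank have an empty side, so their `ψ` factor is `0` unless the
other side is empty too. -/
theorem card_rankedGap (α : Type) [Fintype α] [DecidableEq α] (k : ℕ) :
    Nat.card {p : (α → Fin k) × (α → α → Prop) // IsRankedGap p.1 p.2} =
      ∑ c : α → Fin k × Bool × Bool, gapWeight (colourCount c) := by
  classical
  let F : (Σ c : {c : α → Fin k × Bool × Bool // ∀ i, ∃ v, c v = (i, false, false)},
      ∀ g, {R : LowerGap c.1 g → UpperGap c.1 g → Prop // IsFerrers R}) →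
      {p : (α → Fin k) × (α → α → Prop) // IsRankedGap p.1 p.2} := fun x =>
    ⟨(fun v => (x.1.1 v).1, assembledGap x.1.1 fun g => (x.2 g).1),
      isRankedGap_assembledGap (fun g => (x.2 g).2) x.1.2⟩
  have hF : Function.Bijective F := by
    constructor
    · rintro ⟨⟨c, hc⟩, R⟩ ⟨⟨c', hc'⟩, R'⟩ h
      have h1 := congrArg (fun p => gapColour p.1.1 p.1.2) h
      have h1 : c = c' := (gapColour_assembledGap fun g => (R g).2).symm.trans
        (h1.trans (gapColour_assembledGap fun g => (R' g).2))
      subst h1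
      have h2 : R = R' := by
        funext g
        refine Subtype.ext (funext fun a => funext fun b => propext ?_)
        rw [← assembledGap_iff (R := fun g => (R g).1), ← assembledGap_iff (R := fun g => (R' g).1)]
        exact iff_of_eq (congrFun (congrFun (congrArg (fun p => p.1.2) h) a.1) b.1)
      subst h2
      rfl
    · rintro ⟨⟨r, T⟩, h⟩
      exact ⟨⟨⟨gapColour r T, h.exists_gapColour_eq⟩, fun g => ⟨_, h.isFerrers g⟩⟩,
        Subtype.ext (Prod.ext rfl h.assembledGap_eq)⟩
  rw [← Nat.card_eq_of_bijective F hF, Nat.card_sigma]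
  simp only [Nat.card_pi, card_isFerrers]
  rw [← Finset.sum_subtype (Finset.univ.filter fun c : α → Fin k × Bool × Bool =>
    ∀ i, ∃ v, c v = (i, false, false)) (by simp)
    fun c => ∏ g, psiTwoTwo (Nat.card (UpperGap c g)) (Nat.card (LowerGap c g)),
    Finset.sum_filter]
  refine Finset.sum_congr rfl fun c _ => ?_
  have h0 : ∀ κ, colourCount c κ ≠ 0 ↔ ∃ v, c v = κ := fun κ => by
    rw [colourCount, Nat.card_ne_zero, nonempty_subtype]
    exact and_iff_left inferInstance
  simp only [gapWeight, h0]
  refine if_congr Iff.rfl (Finset.prod_congr rfl fun g _ => ?_) rfl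
  rw [card_subtype_eq_sum_colourCount c fun κ => κ.1.castSucc = g ∧ κ.2.1 = true,
    card_subtype_eq_sum_colourCount c fun κ => κ.1.succ = g ∧ κ.2.2 = true]

end Colour

/-! ### Exponential generating functions of weighted colourings -/

section Exponential

variable {K : Type} [Fintype K]

/-- The exponential monomial `x ^ n / n!`. -/
noncomputable def expMonomial (n : ℕ) : ℚ⟦X⟧ := PowerSeries.monomial n (1 / (n ! : ℚ))

theorem X_pow_dvd_expMonomial (n : ℕ) : (PowerSeries.X : ℚ⟦X⟧) ^ n ∣ expMonomial n := by
  rw [expMonomial, PowerSeries.monomial_eq_C_mul_X_pow]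
  exact dvd_mul_left _ _

theorem coeff_prod_expMonomial (s : K → ℕ) (n : ℕ) :
    PowerSeries.coeff n (∏ κ, expMonomial (s κ)) =
      if ∑ κ, s κ = n then ∏ κ, (1 / ((s κ)! : ℚ)) else 0 := by
  simp only [expMonomial, PowerSeries.monomial_eq_C_mul_X_pow, Finset.prod_mul_distrib,
    Finset.prod_pow_eq_pow_sum, ← map_prod, PowerSeries.coeff_C_mul_X_pow, eq_comm]

theorem X_pow_dvd_prod_expMonomial (s : K → ℕ) :
    (PowerSeries.X : ℚ⟦X⟧) ^ (∑ κ, s κ) ∣ ∏ κ, expMonomial (s κ) := by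
  rw [← Finset.prod_pow_eq_pow_sum]
  exact Finset.prod_dvd_prod_of_dvd _ _ fun κ _ => X_pow_dvd_expMonomial (s κ)

theorem finite_sum_le (d : ℕ) : {s : K → ℕ | ∑ κ, s κ ≤ d}.Finite := by
  classical
  refine (Set.finite_Icc (0 : K → ℕ) fun _ => d).subset fun s hs => ⟨fun κ => Nat.zero_le _,
    fun κ => ?_⟩
  exact (Finset.single_le_sum (fun _ _ => Nat.zero_le _) (Finset.mem_univ κ)).trans hs

/-- Both sides are the coefficient of the monomial with exponents `s` in the `n`-th power of the sum
of the variables. -/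
theorem card_colourCount_eq (n : ℕ) (s : K → ℕ) (hs : ∑ κ, s κ = n) :
    Nat.card {c : Fin n → K // colourCount c = s} = Nat.multinomial Finset.univ s := by
  classical
  let s' : K →₀ ℕ := Finsupp.equivFunOnFinite.symm s
  have h := MvPolynomial.coeff_sum_X_pow_of_fintype (R := ℚ) s' n
  have hsum : s'.sum (fun _ m => m) = n := by
    rw [Finsupp.sum_fintype _ _ fun _ => rfl]
    exact hs
  rw [if_pos hsum, Fintype.sum_pow, MvPolynomial.coeff_sum] at h
  rw [Finsupp.multinomial_eq_of_support_subset (Finset.subset_univ _)] at h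
  have hm : ∀ c : Fin n → K, MvPolynomial.coeff s' (∏ i, (MvPolynomial.X (c i) :
      MvPolynomial K ℚ)) = if colourCount c = s then 1 else 0 := by
    intro c
    have : (∏ i, (MvPolynomial.X (c i) : MvPolynomial K ℚ)) =
        MvPolynomial.monomial (Finsupp.equivFunOnFinite.symm (colourCount c)) 1 := by
      rw [MvPolynomial.monomial_eq, Finsupp.prod_fintype _ _ fun _ => pow_zero _, map_one, one_mul,
        ← Finset.prod_fiberwise' Finset.univ c fun κ => (MvPolynomial.X κ : MvPolynomial K ℚ)]
      refine Finset.prod_congr rfl fun κ _ => ?_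
      rw [Finset.prod_const]
      congr 1
      simp [colourCount, Fintype.card_subtype]
    rw [this, MvPolynomial.coeff_monomial]
    simp [s']
  simp only [hm, Finset.sum_boole] at h
  rw [Nat.card_eq_fintype_card, Fintype.card_subtype]
  exact_mod_cast h

theorem egf_sum_colourCount (w : (K → ℕ) → ℕ) (n : ℕ) [DecidableEq K] :
    ((∑ c : Fin n → K, w (colourCount c) : ℕ) : ℚ) / n ! =
      PowerSeries.coeff n (formalSum fun s : K → ℕ =>
        PowerSeries.C (w s : ℚ) * ∏ κ, expMonomial (s κ)) := by
  classical
  have hmap : ∀ c : Fin n → K, c ∈ Finset.univ →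
      colourCount c ∈ Finset.piAntidiag (Finset.univ : Finset K) n := by
    intro c _
    rw [Finset.mem_piAntidiag]
    refine ⟨?_, fun _ _ => Finset.mem_univ _⟩
    have := card_subtype_eq_sum_colourCount c fun _ => True
    simpa using this.symm
  rw [coeff_formalSum, finsum_eq_sum_of_support_subset
    (s := Finset.piAntidiag (Finset.univ : Finset K) n),
    ← Finset.sum_fiberwise_of_maps_to hmap, Nat.cast_sum, Finset.sum_div]
  · refine Finset.sum_congr rfl fun s hs => ?_
    rw [Finset.mem_piAntidiag] at hs
    have hcard := card_colourCount_eq n s hs.1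
    rw [Nat.card_eq_fintype_card, Fintype.card_subtype] at hcard
    rw [Finset.sum_congr rfl fun c hc => by rw [(Finset.mem_filter.1 hc).2], Finset.sum_const,
      hcard, smul_eq_mul, PowerSeries.coeff_C_mul, coeff_prod_expMonomial, if_pos hs.1]
    have hspec := Nat.multinomial_spec Finset.univ s
    rw [hs.1] at hspec
    rw [← hspec]
    have h1 : (∏ κ, ((s κ)! : ℚ)) ≠ 0 := Finset.prod_ne_zero_iff.2 fun κ _ => by positivity
    have h2 : (Nat.multinomial Finset.univ s : ℚ) ≠ 0 := by
      exact_mod_cast (Nat.multinomial_pos Finset.univ s).ne'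
    simp only [one_div, Finset.prod_inv_distrib]
    push_cast
    field_simp
  · intro s hs
    rw [Function.mem_support, PowerSeries.coeff_C_mul, coeff_prod_expMonomial] at hs
    rw [Finset.mem_coe, Finset.mem_piAntidiag]
    refine ⟨?_, fun _ _ => Finset.mem_univ _⟩
    by_contra h
    exact hs (by rw [if_neg h, mul_zero])

end Exponential

/-! ### Transfer of colour counts from rank to rank -/

/-- The numbers of vertices of a rank that are universal in both directions, only downwards, in no
direction, and only upwards. -/
abbrev LevelCount : Type := ℕ × ℕ × ℕ × ℕ

/-- The exponential monomial of the vertices of a rank. -/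
noncomputable def levelMonomial (z : LevelCount) : ℚ⟦X⟧ :=
  expMonomial z.1 * (expMonomial z.2.1 * (expMonomial z.2.2.1 * expMonomial z.2.2.2))

/-- The number of gap relations for the given numbers of vertices of each colour, when `n` vertices
that are not universal downwards follow above the highest rank. -/
def openWeight {k : ℕ} (ζ : Fin k → LevelCount) (n : ℕ) : ℕ :=
  (∏ i, if (ζ i).1 = 0 then 0 else 1) *
    ∏ g : Fin (k + 1), psiTwoTwo
      (Fin.snoc (α := fun _ => ℕ) (fun i => (ζ i).2.2.1 + (ζ i).2.2.2) n g)
      (Fin.cons (α := fun _ => ℕ) 0 (fun i => (ζ i).2.1 + (ζ i).2.2.1) g)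

/-- Seen from the ranks of `ζ`, the new top rank matters only through its vertices with a gap
neighbour below; their number takes the place of `n`. -/
theorem openWeight_snoc {k : ℕ} (ζ : Fin k → LevelCount) (z : LevelCount) (n : ℕ) :
    openWeight (Fin.snoc (α := fun _ => LevelCount) ζ z) n =
      openWeight ζ (z.2.2.1 + z.2.2.2) *
        ((if z.1 = 0 then 0 else 1) * psiTwoTwo n (z.2.1 + z.2.2.1)) := by
  have h : ∀ g : Fin (k + 1), psiTwoTwo
      (Fin.snoc (α := fun _ => ℕ) (fun i => ((Fin.snoc (α := fun _ => LevelCount) ζ z :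
        Fin (k + 1) → LevelCount) i).2.2.1 +
        ((Fin.snoc (α := fun _ => LevelCount) ζ z : Fin (k + 1) → LevelCount) i).2.2.2) n g.castSucc)
      (Fin.cons (α := fun _ => ℕ) 0 (fun i => ((Fin.snoc (α := fun _ => LevelCount) ζ z :
        Fin (k + 1) → LevelCount) i).2.1 +
        ((Fin.snoc (α := fun _ => LevelCount) ζ z : Fin (k + 1) → LevelCount) i).2.2.1) g.castSucc) =
      psiTwoTwo
      (Fin.snoc (α := fun _ => ℕ) (fun i => (ζ i).2.2.1 + (ζ i).2.2.2) (z.2.2.1 + z.2.2.2) g)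
      (Fin.cons (α := fun _ => ℕ) 0 (fun i => (ζ i).2.1 + (ζ i).2.2.1) g) := by
    intro g
    congr 1
    · rw [Fin.snoc_castSucc]
      induction g using Fin.lastCases with
      | last => simp only [Fin.snoc_last]
      | cast i => simp only [Fin.snoc_castSucc]
    · induction g using Fin.cases with
      | zero => simp only [Fin.castSucc_zero, Fin.cons_zero]
      | succ i => simp only [Fin.castSucc_succ, Fin.cons_succ, Fin.snoc_castSucc]
  unfold openWeight
  rw [Fin.prod_univ_castSucc, Fin.prod_univ_castSucc (n := k + 1),
    Finset.prod_congr rfl fun g _ => h g, Fin.cons_last]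
  simp only [Fin.snoc_castSucc, Fin.snoc_last]
  ring

/-- The numbers of vertices of each colour, arranged by ranks. -/
def levelsEquiv (k : ℕ) : (Fin k × Bool × Bool → ℕ) ≃ (Fin k → LevelCount) where
  toFun s i := (s (i, false, false), s (i, false, true), s (i, true, true), s (i, true, false))
  invFun ζ κ := match κ with
    | (i, false, false) => (ζ i).1
    | (i, false, true) => (ζ i).2.1
    | (i, true, true) => (ζ i).2.2.1
    | (i, true, false) => (ζ i).2.2.2
  left_inv s := by
    funext ⟨i, a, b⟩
    cases a <;> cases b <;> rfl
  right_inv ζ := rfl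

theorem openWeight_levelsEquiv {k : ℕ} (s : Fin k × Bool × Bool → ℕ) :
    openWeight (levelsEquiv k s) 0 = gapWeight s := by
  have h : (∏ i, if ((levelsEquiv k s) i).1 = 0 then 0 else 1) =
      if ∀ i, s (i, false, false) ≠ 0 then 1 else 0 := by
    split_ifs with h
    · exact Finset.prod_eq_one fun i _ => if_neg (h i)
    · push Not at h
      obtain ⟨i, hi⟩ := h
      exact Finset.prod_eq_zero (Finset.mem_univ i) (if_pos hi)
  rw [openWeight, gapWeight, h, ite_mul, one_mul, zero_mul]
  refine if_congr Iff.rfl (Finset.prod_congr rfl fun g _ => ?_) rfl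
  simp only [Finset.sum_filter, Fintype.sum_prod_type, Fintype.sum_bool]
  congr 1
  · induction g using Fin.lastCases with
    | last => simp [Fin.castSucc_ne_last]
    | cast i => simp [levelsEquiv, Finset.sum_add_distrib]
  · induction g using Fin.cases with
    | zero => simp [Fin.succ_ne_zero]
    | succ i => simp [levelsEquiv, Finset.sum_add_distrib, add_comm]

theorem prod_levelMonomial_levelsEquiv {k : ℕ} (s : Fin k × Bool × Bool → ℕ) :
    ∏ i, levelMonomial (levelsEquiv k s i) = ∏ κ, expMonomial (s κ) := by
  simp only [Fintype.prod_prod_type, Fintype.prod_bool]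
  refine Finset.prod_congr rfl fun i _ => ?_
  simp only [levelMonomial, levelsEquiv, Equiv.coe_fn_mk]
  ring

/-- The generating function of colourings of `k` ranks that are followed by `n` vertices which are
not universal downwards. -/
noncomputable def openSeries (k n : ℕ) : ℚ⟦X⟧ :=
  formalSum fun ζ : Fin k → LevelCount =>
    PowerSeries.C (openWeight ζ n : ℚ) * ∏ i, levelMonomial (ζ i)

theorem openSeries_zero_right (k : ℕ) :
    openSeries k 0 = formalSum fun s : Fin k × Bool × Bool → ℕ =>
      PowerSeries.C (gapWeight s : ℚ) * ∏ κ, expMonomial (s κ) := by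
  rw [openSeries, ← formalSum_comp_equiv (levelsEquiv k)]
  simp only [openWeight_levelsEquiv, prod_levelMonomial_levelsEquiv]

theorem formallySummable_openSeries (k n : ℕ) :
    FormallySummable fun ζ : Fin k → LevelCount =>
      PowerSeries.C (openWeight ζ n : ℚ) * ∏ i, levelMonomial (ζ i) := by
  have h : FormallySummable fun s : Fin k × Bool × Bool → ℕ =>
      PowerSeries.C (openWeight (levelsEquiv k s) n : ℚ) * ∏ κ, expMonomial (s κ) :=
    .of_dvd (fun s => ∑ κ, s κ) (fun s => (X_pow_dvd_prod_expMonomial s).mul_left _)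
      (fun d => finite_sum_le d)
  convert! h.comp_injective (levelsEquiv k).symm.injective using 2 with ζ
  rw [← prod_levelMonomial_levelsEquiv, Equiv.apply_symm_apply]

theorem openSeries_succ_eq_formalSum (k n : ℕ) :
    openSeries (k + 1) n = formalSum fun z : LevelCount =>
      PowerSeries.C (((if z.1 = 0 then 0 else 1) * psiTwoTwo n (z.2.1 + z.2.2.1) : ℕ) : ℚ) *
        levelMonomial z * openSeries k (z.2.2.1 + z.2.2.2) := by
  have hs := (formallySummable_openSeries (k + 1) n).comp_injective
    (Fin.snocEquiv fun _ => LevelCount).injective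
  rw [openSeries, ← formalSum_comp_equiv (Fin.snocEquiv fun _ => LevelCount), formalSum_prod hs]
  congr 1
  ext1 z
  rw [openSeries, ← formalSum_mul_left (formallySummable_openSeries k _)]
  congr 1
  ext1 ζ
  have h1 : (Fin.snocEquiv fun _ => LevelCount) (z, ζ) =
    (Fin.snoc (α := fun _ => LevelCount) ζ z : Fin (k + 1) → LevelCount) := rfl
  rw [h1, openWeight_snoc, Fin.prod_univ_castSucc, Nat.cast_mul, map_mul]
  simp only [Fin.snoc_castSucc, Fin.snoc_last]
  ring

theorem formallySummable_expMonomial_mul (f : ℕ → ℚ⟦X⟧) :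
    FormallySummable fun n => expMonomial n * f n :=
  .of_dvd id (fun n => (X_pow_dvd_expMonomial n).mul_right _) fun d => Set.finite_Iic d

theorem finite_prod_le {ι κ : Type} {a : ι → ℕ} {b : κ → ℕ} (ha : ∀ d, {i | a i ≤ d}.Finite)
    (hb : ∀ d, {j | b j ≤ d}.Finite) (d : ℕ) : {p : ι × κ | a p.1 + b p.2 ≤ d}.Finite := by
  refine ((ha d).prod (hb d)).subset fun p hp => ?_
  simp only [Set.mem_ofPred_eq, Set.mem_prod] at hp ⊢
  omega

theorem expSubOne_eq_formalSum :
    expSubOne = formalSum fun u : ℕ => expMonomial u * PowerSeries.C (if u = 0 then 0 else 1) := by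
  ext d
  rw [coeff_formalSum, finsum_eq_single _ d]
  · rcases d with _ | d
    · simp [expSubOne, expMonomial]
    · simp [expSubOne, expMonomial, PowerSeries.coeff_exp, PowerSeries.coeff_one]
  · intro u hu
    rw [mul_comm, PowerSeries.coeff_C_mul, expMonomial, PowerSeries.coeff_monomial,
      if_neg hu.symm, mul_zero]

/-- An entry of the transfer matrix without the factor `x ^ n / n!` of its column. -/
noncomputable def reducedTransfer (m n : ℕ) : ℚ⟦X⟧ :=
  formalSum fun l : ℕ => expMonomial l *
    PowerSeries.C (∑ m' ∈ Finset.range (m + 1), (m.choose m' : ℚ) * (psiTwoTwo n (l + m') : ℚ))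

theorem transferTerm_eq (m n l : ℕ) :
    transferTerm m n l = expMonomial n * (expMonomial l *
      PowerSeries.C (∑ m' ∈ Finset.range (m + 1),
        (m.choose m' : ℚ) * (psiTwoTwo n (l + m') : ℚ))) := by
  simp only [transferTerm, expMonomial, PowerSeries.monomial_eq_C_mul_X_pow, pow_add, map_mul,
    one_div, mul_inv]
  ring

theorem formallySummable_transferTerm (m n : ℕ) :
    FormallySummable fun l => transferTerm m n l := by
  simp only [transferTerm_eq]
  exact (formallySummable_expMonomial_mul _).mul_left _

theorem transferMatrix_eq (m n : ℕ) :
    transferMatrix m n = expMonomial n * reducedTransfer m n := by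
  simp only [transferMatrix, transferTerm_eq, reducedTransfer]
  exact formalSum_mul_left (formallySummable_expMonomial_mul _) _

theorem rowFinite_transferMatrix : RowFinite transferMatrix := by
  intro m d
  refine ⟨d, fun p hp => ?_⟩
  rw [transferMatrix_eq]
  exact ((pow_dvd_pow _ hp).trans (X_pow_dvd_expMonomial p)).mul_right _

theorem expMonomial_mul_expMonomial (i j : ℕ) :
    expMonomial i * expMonomial j =
      PowerSeries.C ((i + j).choose i : ℚ) * expMonomial (i + j) := by
  simp only [expMonomial]
  rw [← PowerSeries.monomial_zero_eq_C_apply, PowerSeries.monomial_mul_monomial,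
    PowerSeries.monomial_mul_monomial, zero_add]
  congr 1
  have h := Nat.add_choose_mul_factorial_mul_factorial i j
  rw [← Nat.choose_symm_add] at h
  have h' : ((i + j).choose i : ℚ) * i ! * j ! = (i + j)! := by exact_mod_cast h
  rw [← h']
  have : ((i + j).choose i : ℚ) ≠ 0 := by
    exact_mod_cast (Nat.choose_pos (Nat.le_add_right i j)).ne'
  field_simp

/-- Source of the binomials in `A`: of the `p` vertices with a gap neighbour below, `q.1` also have
one above. -/
theorem sum_antidiagonal_expMonomial_mul (p n : ℕ) :
    ∑ q ∈ Finset.HasAntidiagonal.antidiagonal p, expMonomial q.1 * expMonomial q.2 *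
        formalSum (fun l => expMonomial l * PowerSeries.C (psiTwoTwo n (l + q.1) : ℚ)) =
      expMonomial p * reducedTransfer p n := by
  have h : reducedTransfer p n = ∑ m' ∈ Finset.range (p + 1), PowerSeries.C (p.choose m' : ℚ) *
      formalSum fun l => expMonomial l * PowerSeries.C (psiTwoTwo n (l + m') : ℚ) := by
    rw [reducedTransfer]
    simp only [map_sum, Finset.mul_sum]
    ext d
    rw [coeff_formalSum, map_sum]
    simp only [← formalSum_mul_left (formallySummable_expMonomial_mul _), coeff_formalSum, map_sum]
    rw [finsum_sum_comm]
    · refine Finset.sum_congr rfl fun m' _ => finsum_congr fun l => ?_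
      congr 1
      rw [map_mul, mul_left_comm]
    · exact fun m' _ => formallySummable_expMonomial_mul _ d
  rw [h, Finset.Nat.sum_antidiagonal_eq_sum_range_succ_mk, Finset.mul_sum]
  refine Finset.sum_congr rfl fun m' hm' => ?_
  have : m' + (p - m') = p := by
    have := Finset.mem_range.1 hm'
    omega
  rw [expMonomial_mul_expMonomial, this]
  ring

/-- In the top rank the number `u ≥ 1` of isolated vertices enters no `ψ` and splits off as `e ^ x -
1`. The gap above depends on `l + q.1`, the gap below on `q.1 + q.2`, with `l` the number of
vertices having a gap neighbour only above. So sum over `l` first, then over `q` with fixed sum `p`.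
-/
theorem openSeries_succ (k n : ℕ) :
    openSeries (k + 1) n = expSubOne *
      formalSum fun p => expMonomial p * (openSeries k p * reducedTransfer p n) := by
  let F : ℕ × ℕ → ℚ⟦X⟧ := fun q =>
    openSeries k (q.1 + q.2) * (expMonomial q.1 * expMonomial q.2)
  let L : ℕ × ℕ × ℕ → ℚ⟦X⟧ := fun y =>
    expMonomial y.1 * PowerSeries.C (psiTwoTwo n (y.1 + y.2.1) : ℚ) * F y.2
  have hle : ∀ d, {i : ℕ | id i ≤ d}.Finite := fun d => Set.finite_Iic d
  have hF : ∀ q, (PowerSeries.X : ℚ⟦X⟧) ^ (id q.1 + id q.2) ∣ F q := fun q => by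
    rw [pow_add]
    exact (mul_dvd_mul (X_pow_dvd_expMonomial _) (X_pow_dvd_expMonomial _)).mul_left _
  have hLd : ∀ y, (PowerSeries.X : ℚ⟦X⟧) ^ (id y.1 + (id y.2.1 + id y.2.2)) ∣ L y := fun y => by
    rw [pow_add]
    exact mul_dvd_mul ((X_pow_dvd_expMonomial _).mul_right _) (hF y.2)
  have hL : FormallySummable L :=
    .of_dvd _ hLd (finite_prod_le hle (finite_prod_le hle hle))
  have hU : FormallySummable fun z : LevelCount =>
      expMonomial z.1 * PowerSeries.C (if z.1 = 0 then 0 else 1) * L z.2 :=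
    .of_dvd (fun z => id z.1 + (id z.2.1 + (id z.2.2.1 + id z.2.2.2)))
      (fun z => by
        rw [pow_add]
        exact mul_dvd_mul ((X_pow_dvd_expMonomial _).mul_right _) (hLd z.2))
      (finite_prod_le hle (finite_prod_le hle (finite_prod_le hle hle)))
  calc openSeries (k + 1) n
      = formalSum fun z : LevelCount =>
          expMonomial z.1 * PowerSeries.C (if z.1 = 0 then 0 else 1) * L z.2 := by
        rw [openSeries_succ_eq_formalSum]
        congr 1
        ext1 z
        simp only [levelMonomial, L, F]
        push_cast
        rw [map_mul]
        ring
    _ = formalSum fun u => expMonomial u * PowerSeries.C (if u = 0 then 0 else 1) *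
          formalSum L := by
        rw [formalSum_prod hU]
        congr 1
        ext1 u
        exact formalSum_mul_left hL (expMonomial u * PowerSeries.C (if u = 0 then 0 else 1))
    _ = expSubOne * formalSum L := by
        rw [formalSum_mul_right (formallySummable_expMonomial_mul _), ← expSubOne_eq_formalSum]
    _ = expSubOne * formalSum fun q : ℕ × ℕ => formalSum fun l => L (l, q) := by
        rw [formalSum_prod hL, formalSum_comm hL]
    _ = expSubOne * formalSum fun q : ℕ × ℕ => F q * formalSum fun l =>
          expMonomial l * PowerSeries.C (psiTwoTwo n (l + q.1) : ℚ) := by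
        congr 2
        ext1 q
        rw [mul_comm, ← formalSum_mul_right (formallySummable_expMonomial_mul _)]
    _ = _ := by
        congr 1
        rw [← formalSum_comp_equiv Finset.HasAntidiagonal.sigmaAntidiagonalEquivProd, formalSum_sigma_fintype]
        · congr 1
          ext1 p
          rw [mul_left_comm, ← sum_antidiagonal_expMonomial_mul, Finset.mul_sum]
          refine Eq.trans (Finset.sum_congr rfl fun q _ => ?_) (Finset.sum_coe_sort _ _)
          simp only [Finset.HasAntidiagonal.sigmaAntidiagonalEquivProd_apply, F,
            Finset.HasAntidiagonal.mem_antidiagonal.1 q.2, mul_assoc]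
        · exact .of_dvd (fun x => id x.2.1.1 + id x.2.1.2) (fun x => (hF _).mul_right _) fun d =>
            (finite_prod_le hle hle d).preimage
              (Finset.HasAntidiagonal.sigmaAntidiagonalEquivProd (A := ℕ)).injective.injOn

/-- Without ranks only the factor `ψ(n, 0)` remains, which is `1` for `n = 0` and `0` otherwise. -/
theorem openSeries_zero (n : ℕ) : openSeries 0 n = (1 : Matrix ℕ ℕ ℚ⟦X⟧) 0 n := by
  rw [openSeries, formalSum_eq_single default fun ζ hζ => absurd (Subsingleton.elim _ _) hζ]
  rcases n with _ | n
  · simp [openWeight, psiTwoTwo, Fin.snoc]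
  · simp [openWeight, psiTwoTwo, Fin.snoc, Matrix.one_apply_ne]

/-- `openSeries` omits the `x ^ n / n!` of the `n` vertices still to come, which is exactly the
column factor of `A`. -/
theorem formalPow_transferMatrix_zero (k n : ℕ) :
    expSubOne ^ k * formalPow transferMatrix k 0 n = expMonomial n * openSeries k n := by
  induction k generalizing n with
  | zero =>
    rw [openSeries_zero, formalPow, pow_zero, one_mul]
    rcases n with _ | n
    · simp [expMonomial]
    · simp [Matrix.one_apply_ne]
  | succ k ih =>
    have hs : FormallySummable fun p => expMonomial p * (openSeries k p * reducedTransfer p n) :=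
      formallySummable_expMonomial_mul _
    rw [openSeries_succ, formalPow, formalMul, pow_succ', mul_assoc, mul_left_comm (expMonomial n),
      ← formalSum_mul_left ((rowFinite_transferMatrix.pow k).multipliable _ 0 n),
      ← formalSum_mul_left hs]
    congr 2
    ext1 p
    rw [← mul_assoc, ih, transferMatrix_eq]
    ring

/-! ### The generating functions -/

theorem coeff_egf (e : ℕ → ℕ) (n : ℕ) : PowerSeries.coeff n (egf e) = (e n : ℚ) / n ! := by
  simp [egf]

theorem egf_numGradedIntervalOrdersOfHeight (k : ℕ) :
    egf (fun n => numGradedIntervalOrdersOfHeight n k) =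
      expSubOne ^ k * formalPow transferMatrix k 0 0 := by
  ext n
  have h0 : expMonomial 0 = 1 := by simp [expMonomial]
  rw [formalPow_transferMatrix_zero, h0, one_mul, openSeries_zero_right, coeff_egf,
    ← egf_sum_colourCount, ← card_rankedGap, ← ncard_graded_eq_card_rankedGap]
  rfl

theorem isGradedPoset_iff {α : Type} [PartialOrder α] :
    IsGradedPoset α ↔ ∃ k, IsGradedOfHeight α k := by
  refine ⟨fun h => ?_, fun ⟨k, h⟩ => h.1⟩
  obtain ⟨t, ht, -⟩ := (IsChain.empty (α := α) (r := (· ≤ ·))).exists_maxChain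
  exact ⟨t.ncard, h, fun s hs => h s t hs ht⟩

theorem IsGradedOfHeight.eq {α : Type} [PartialOrder α] {k k' : ℕ} (h : IsGradedOfHeight α k)
    (h' : IsGradedOfHeight α k') : k = k' := by
  obtain ⟨t, ht, -⟩ := (IsChain.empty (α := α) (r := (· ≤ ·))).exists_maxChain
  rw [← h.2 t ht, h'.2 t ht]

theorem IsGradedOfHeight.le_card {α : Type} [PartialOrder α] [Finite α] {k : ℕ}
    (h : IsGradedOfHeight α k) : k ≤ Nat.card α := by
  obtain ⟨t, ht, -⟩ := (IsChain.empty (α := α) (r := (· ≤ ·))).exists_maxChain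
  rw [← h.2 t ht, ← Set.ncard_univ]
  exact Set.ncard_le_ncard (Set.subset_univ t) Set.finite_univ

theorem numGradedIntervalOrders_eq_sum (n : ℕ) :
    numGradedIntervalOrders n =
      ∑ k ∈ Finset.range (n + 1), numGradedIntervalOrdersOfHeight n k := by
  have hfin : ∀ s : Set (PartialOrder (Fin n)), s.Finite := fun s => by
    have : Finite (PartialOrder (Fin n)) := Finite.of_injective
      (fun P : PartialOrder (Fin n) => P.le) fun P Q h => PartialOrder.ext fun a b => by
        exact iff_of_eq (congrFun (congrFun h a) b)
    exact Set.toFinite s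
  have h : {P : PartialOrder (Fin n) | @IsIntervalOrder (Fin n) P ∧ @IsGradedPoset (Fin n) P} =
      ⋃ k ∈ Finset.range (n + 1), {P : PartialOrder (Fin n) |
        @IsIntervalOrder (Fin n) P ∧ @IsGradedOfHeight (Fin n) P k} := by
    ext P
    simp only [Set.mem_iUnion, Set.mem_ofPred_eq, isGradedPoset_iff, exists_prop]
    constructor
    · rintro ⟨hi, k, hk⟩
      have := hk.le_card
      rw [Nat.card_fin] at this
      exact ⟨k, Finset.mem_range.2 (by omega), hi, hk⟩
    · rintro ⟨k, -, hi, hk⟩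
      exact ⟨hi, k, hk⟩
  rw [numGradedIntervalOrders, h]
  refine ((Finset.finite_toSet _).ncard_biUnion (fun k _ => hfin _) fun k _ k' _ hne => ?_).trans
    (finsum_mem_coe_finset _ _)
  exact Set.disjoint_left.2 fun P hP hP' => hne (hP.2.eq hP'.2)

theorem X_dvd_expSubOne : (PowerSeries.X : ℚ⟦X⟧) ∣ expSubOne := by
  rw [PowerSeries.X_dvd_iff]
  simp [expSubOne]

theorem egf_numGradedIntervalOrders :
    egf numGradedIntervalOrders = formalGeometric (expSubOne • transferMatrix) 0 0 := by
  have hX : ∀ m n, (PowerSeries.X : ℚ⟦X⟧) ∣ (expSubOne • transferMatrix) m n :=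
    fun m n => X_dvd_expSubOne.mul_right _
  ext n
  rw [formalGeometric, coeff_formalSum, finsum_eq_sum_of_support_subset
    (s := Finset.range (n + 1)), coeff_egf, numGradedIntervalOrders_eq_sum, Nat.cast_sum,
    Finset.sum_div]
  · refine Finset.sum_congr rfl fun k _ => ?_
    rw [formalPow_smul rowFinite_transferMatrix, Matrix.smul_apply, smul_eq_mul,
      ← egf_numGradedIntervalOrdersOfHeight, coeff_egf]
  · intro k hk
    by_contra h
    refine hk (PowerSeries.X_pow_dvd_iff.1 (X_pow_dvd_formalPow hX k 0 0) n ?_)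
    simpa using h

theorem numGradedIntervalOrders_zero : numGradedIntervalOrders 0 = 1 := by
  have h := congrArg (PowerSeries.coeff 0) (egf_numGradedIntervalOrdersOfHeight 0)
  rw [coeff_egf] at h
  rw [numGradedIntervalOrders_eq_sum, zero_add, Finset.sum_range_one]
  simpa [formalPow] using h

theorem egf_numGradedIntervalOrders_pos :
    egf (fun n => if n = 0 then 0 else numGradedIntervalOrders n) =
      egf numGradedIntervalOrders - 1 := by
  ext n
  rw [map_sub, coeff_egf, coeff_egf, PowerSeries.coeff_one]
  rcases n with _ | n
  · simp [numGradedIntervalOrders_zero]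
  · simp

/-- The exponential generating functions of graded interval orders, by height and in total. The
first two clauses say that the entries of `A` and of its powers exist. -/
theorem mainTheorem3 :
    (∀ m n : ℕ, FormallySummable fun l : ℕ => transferTerm m n l) ∧
    (∀ k : ℕ, FormallyMultipliable (formalPow transferMatrix k) transferMatrix) ∧
    (∀ k : ℕ, egf (fun n => numGradedIntervalOrdersOfHeight n k) =
      expSubOne ^ k * formalPow transferMatrix k 0 0) ∧
    ∃ B : Matrix ℕ ℕ ℚ⟦X⟧,
      IsFormalInverse (1 - expSubOne • transferMatrix) B ∧
      (∀ C : Matrix ℕ ℕ ℚ⟦X⟧,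
        IsFormalInverse (1 - expSubOne • transferMatrix) C → C = B) ∧
      egf numGradedIntervalOrders = B 0 0 ∧
      FormallyMultipliable B transferMatrix ∧
      egf (fun n => if n = 0 then 0 else numGradedIntervalOrders n) =
        expSubOne * formalMul B transferMatrix 0 0 := by
  have hG : RowFinite (expSubOne • transferMatrix) := rowFinite_transferMatrix.smul _
  have hX : ∀ m n, (PowerSeries.X : ℚ⟦X⟧) ∣ (expSubOne • transferMatrix) m n :=
    fun m n => X_dvd_expSubOne.mul_right _
  have hB := hG.geometric hX
  have hinv := isFormalInverse_geometric hG hX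
  refine ⟨formallySummable_transferTerm,
    fun k => (rowFinite_transferMatrix.pow k).multipliable _,
    egf_numGradedIntervalOrdersOfHeight, formalGeometric (expSubOne • transferMatrix), hinv,
    fun C hC => hinv.unique (RowFinite.one.sub hG) hB hC, egf_numGradedIntervalOrders,
    hB.multipliable _, ?_⟩
  -- With `B` the geometric series, `B ((e ^ x - 1) A) = B - 1`; at the corner the subtracted `1` is
  -- the empty poset.
  have h := congrFun (congrFun (geometric_formalMul hG hX) 0) 0
  rw [formalMul_smul hB, Matrix.smul_apply, smul_eq_mul, Matrix.sub_apply,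
    Matrix.one_apply_eq] at h
  rw [h, egf_numGradedIntervalOrders_pos, egf_numGradedIntervalOrders]
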